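/- Let $g\ge 0$ and let $\mathbb{R}\langle x,x^T\rangle$ be the ring of real noncommutative (nc) polynomials in the variables $x=(x_1,\dots,x_g)$ and their formal transposes $x^T=(x_1^T,\dots,x_g^T)$, with the involution $p\mapsto p^T$ that is $\mathbb{R}$-linear, reverses products and exchanges $x_j$ and $x_j^T$. Call $p$ symmetric if $p^T=p$, and nc analytic if it contains none of the variables $x_j^T$ (constants are allowed). For $X\in(\mathbb{R}^{n\times n})^g$ let $p(X,X^T)$ be the matrix obtained by replacing $x_j$ by $X_j$ and $x_j^T$ by the transpose of $X_j$. The nc complex hessian of $p$ is the nc polynomial in $x,h,x^T,h^T$, where $h=(h_1,\dots,h_g)$, $$q(x,x^T)[h,h^T]=\frac{\partial^2}{\partial s\,\partial t}\,p(x+th,\;y+sk)\Big|_{t=s=0}\Big|_{y=x^T,\;k=h^T}.$$ A set $\mathcal{G}\subseteq\bigcup_{n\ge1}(\mathbb{R}^{n\times n})^g$ is called nc open if it is closed under direct sums of nonempty finite families of its elements (repetitions allowed; the sum of tuples is taken entry by entry and has as its size the sum of the sizes) and if there is a positive integer $n_0$ such that $\mathcal{G}\cap(\mathbb{R}^{n\times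 n})^g$ is open in $(\mathbb{R}^{n\times n})^g$ for every $n>n_0$. A symmetric nc polynomial $p$ with nc complex hessian $q$ is called nc plurisubharmonic on $\mathcal{G}$ if $q(X,X^T)[H,H^T]$ is positive semidefinite for every $n\ge1$, every $X\in\mathcal{G}\cap(\mathbb{R}^{n\times n})^g$ and every $H\in(\mathbb{R}^{n\times n})^g$, and nc plurisubharmonic everywhere if this holds for all $X,H\in(\mathbb{R}^{n\times n})^g$ and all $n\ge1$. **Theorem.** If a symmetric nc polynomial $p$ is nc plurisubharmonic on some nonempty nc open set, then $p$ is nc plurisubharmonic everywhere, and $$p=\sum_{j} f_j^T f_j+\sum_{j} k_j k_j^T+F+F^T,$$ where the sums are finite (possibly empty) and all $f_j$, $k_j$ and $F$ are nc analytic polynomials. -/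

import Mathlib

/-- Noncommutative real polynomials in the variables `x_j` and their formal transposes `x_j^T`,
for `j : σ`: the free algebra on two copies of `σ`. The generator `Sum.inl j` is `x_j` and
the generator `Sum.inr j` is `x_j^T`. -/
abbrev NCPoly (σ : Type) : Type := FreeAlgebra ℝ (σ ⊕ σ)

namespace NCPoly

/-- The variable `x_j`. -/
def x {σ : Type} (j : σ) : NCPoly σ := FreeAlgebra.ι ℝ (Sum.inl j)

/-- The formal transpose `x_j^T` of the variable `x_j`. -/
def xT {σ : Type} (j : σ) : NCPoly σ := FreeAlgebra.ι ℝ (Sum.inr j)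

/-- The involution `p ↦ p^T`: the `ℝ`-linear map that reverses products and exchanges
`x_j` and `x_j^T`. -/
noncomputable def transpose {σ : Type} (p : NCPoly σ) : NCPoly σ :=
  MulOpposite.unop (FreeAlgebra.lift ℝ
    (Sum.elim (fun j => MulOpposite.op (xT j)) (fun j => MulOpposite.op (x j)) :
      σ ⊕ σ → (NCPoly σ)ᵐᵒᵖ) p)

/-- `p` is symmetric if `p^T = p`. -/
def IsSymmetric {σ : Type} (p : NCPoly σ) : Prop := transpose p = p

/-- `p` is nc analytic if it contains only the variables `x_j` and no `x_j^T`: it lies in the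
unital subalgebra generated by the `x_j`. -/
def IsAnalytic {σ : Type} (p : NCPoly σ) : Prop :=
  p ∈ Algebra.adjoin ℝ (Set.range (x : σ → NCPoly σ))

/-- The evaluation `p(X, X^T)` at a tuple of real `n × n` matrices. -/
noncomputable def evalMat {σ : Type} {n : ℕ} (X : σ → Matrix (Fin n) (Fin n) ℝ) (p : NCPoly σ) :
    Matrix (Fin n) (Fin n) ℝ :=
  FreeAlgebra.lift ℝ (Sum.elim X (fun j => (X j).transpose)) p

/-- `p` is matrix positive if `p(X, X^T)` is positive semidefinite for all tuples of matrices
of every size `n ≥ 1`. -/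
def MatrixPositive {σ : Type} (p : NCPoly σ) : Prop :=
  ∀ n : ℕ, 1 ≤ n → ∀ X : σ → Matrix (Fin n) (Fin n) ℝ, (evalMat X p).PosSemidef

/-- The polynomial `p(x + t h, x^T + s h^T)`, where `t` and `s` are central variables: `t` is the
variable of the outer and `s` the variable of the inner polynomial ring. The coefficients are
nc polynomials in the variables `x_j` (indexed by `Sum.inl j`), `h_j` (indexed by `Sum.inr j`) and
their formal transposes. -/
noncomputable def perturb {σ : Type} (p : NCPoly σ) : Polynomial (Polynomial (NCPoly (σ ⊕ σ))) :=
  FreeAlgebra.lift ℝ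
    (Sum.elim
      (fun j => Polynomial.C (Polynomial.C (x (Sum.inl j)))
        + Polynomial.X * Polynomial.C (Polynomial.C (x (Sum.inr j))))
      (fun j => Polynomial.C (Polynomial.C (xT (Sum.inl j)))
        + Polynomial.C (Polynomial.X * Polynomial.C (xT (Sum.inr j)))) :
      σ ⊕ σ → Polynomial (Polynomial (NCPoly (σ ⊕ σ)))) p

/-- The nc complex hessian `q(x, x^T)[h, h^T]`, the value at `t = s = 0` of
`∂²/∂s∂t p(x + t h, x^T + s h^T)`, an nc polynomial in `x, h, x^T, h^T`. -/
noncomputable def complexHessian {σ : Type} (p : NCPoly σ) : NCPoly (σ ⊕ σ) :=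
  (Polynomial.derivative ((Polynomial.derivative (perturb p)).eval 0)).eval 0

/-- `p` is nc plurisubharmonic (everywhere): its nc complex hessian is matrix positive, that is,
`q(X, X^T)[H, H^T]` is positive semidefinite for all `X`, `H` of every size. -/
def IsPlush {σ : Type} (p : NCPoly σ) : Prop := MatrixPositive (complexHessian p)

end NCPoly

/-- The direct sum of finitely many tuples of square matrices of sizes `n 0, …, n (t - 1)`, taken
entry by entry, as a tuple of square matrices of size `n 0 + … + n (t - 1)`. -/
def directSumTuple {σ : Type} {t : ℕ} {n : Fin t → ℕ}
    (X : (j : Fin t) → σ → Matrix (Fin (n j)) (Fin (n j)) ℝ) :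
    σ → Matrix (Fin (∑ j, n j)) (Fin (∑ j, n j)) ℝ :=
  fun i => Matrix.reindex finSigmaFinEquiv finSigmaFinEquiv
    (Matrix.blockDiagonal' (fun j => X j i))

/-- A graded set of matrix tuples, given by its part `G n` of size `n` for every `n`, respects
direct sums: direct sums of nonempty finite families of members (repetitions allowed) are members.
Only sizes `n ≥ 1` matter. -/
def RespectsDirectSums {σ : Type} (G : (n : ℕ) → Set (σ → Matrix (Fin n) (Fin n) ℝ)) : Prop :=
  ∀ (t : ℕ) (n : Fin t → ℕ), 1 ≤ t → (∀ j, 1 ≤ n j) →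
    ∀ X : (j : Fin t) → σ → Matrix (Fin (n j)) (Fin (n j)) ℝ,
      (∀ j, X j ∈ G (n j)) → directSumTuple X ∈ G (∑ j, n j)

/-- A graded set of matrix tuples is nc open if it respects direct sums and its parts of
sufficiently large size are open. -/
def IsNCOpen {σ : Type} (G : (n : ℕ) → Set (σ → Matrix (Fin n) (Fin n) ℝ)) : Prop :=
  RespectsDirectSums G ∧ ∃ n₀ : ℕ, 1 ≤ n₀ ∧ ∀ n : ℕ, n₀ < n → IsOpen (G n)

/-- `p` is nc plurisubharmonic on `G`: `q(X, X^T)[H, H^T]` is positive semidefinite for all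
`X ∈ G` and all `H` of the same size, for every size `n ≥ 1`. -/
def NCPoly.IsPlushOn {σ : Type} (G : (n : ℕ) → Set (σ → Matrix (Fin n) (Fin n) ℝ))
    (p : NCPoly σ) : Prop :=
  ∀ n : ℕ, 1 ≤ n → ∀ X ∈ G n, ∀ H : σ → Matrix (Fin n) (Fin n) ℝ,
    (NCPoly.evalMat (Sum.elim X H) (NCPoly.complexHessian p)).PosSemidef

/-! The complex hessian is tested at one well-chosen point. Let `d` bound the degree of `p`. Along a
line from a point of an open part of `G` towards truncated Fock operators, a certain determinant is
a nonzero polynomial. So there are `X` in `G` and a vector `v` for which the vectors `w(X) v`, with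
`w` a word of length at most `d`, are linearly independent (`exists_dual_words`). The sum `X ⊕ X`
lies in `G` and the direction `H` is unrestricted. An off-diagonal `H` decouples `h_j` from `h_j^T`,
so by independence the vectors which the `h`-letters produce can be prescribed as an arbitrary
family `y` indexed by words. Positivity of the hessian thus becomes nonnegativity of a quadratic
form in `y` built from the coefficients of `p` (`sum_splitForm_nonneg`).

Two kinds of `y` suffice. With `y` concentrated on two words, a vanishing diagonal entry kills its
column (`IsSymmetric.coeff_eq_zero_of_diagonal`). A word that changes letter type twice would then
force ever longer words into the support, so every word of `p` is `s^* t` with `s`, `t` pure of the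
same type (`IsSymmetric.exists_isPure_of_mem_support`). For the telescoping families `pureFamily`
the form collapses to `|e|^2 ∑ ζ_s ζ_t coeff(s^* t)`, so the Gram matrix of each type is positive
semidefinite (`IsSymmetric.posSemidef_gram`). Rank-one decompositions give the squares: `f^T f` from
words in `x`, `k k^T` from words in `x^T`. The remaining words are pure, and symmetry pairs them
into `F + F^T`.

Plurisubharmonicity everywhere is read off the decomposition: by the Leibniz rule the hessian of
such a sum is a sum of squares (`isPlush_sum_squares`). -/

open Polynomial in
theorem Polynomial.coeff_one_coeff_one_mul {A : Type*} [Ring A] (P Q : A[X][X]) :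
    ((P * Q).coeff 1).coeff 1 =
      (P.coeff 0).coeff 0 * (Q.coeff 1).coeff 1 + (P.coeff 0).coeff 1 * (Q.coeff 1).coeff 0
      + ((P.coeff 1).coeff 0 * (Q.coeff 0).coeff 1
        + (P.coeff 1).coeff 1 * (Q.coeff 0).coeff 0) := by
  simp [Polynomial.coeff_mul, Finset.Nat.antidiagonal_succ]

/-! ### Words, coefficients and the involution -/

namespace NCPoly

variable {σ : Type}

/-- The involution on words that reverses the order and exchanges `x_j` and `x_j^T`. -/
def wordStar (w : List (σ ⊕ σ)) : List (σ ⊕ σ) := (w.map Sum.swap).reverse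

@[simp] theorem wordStar_nil : wordStar ([] : List (σ ⊕ σ)) = [] := rfl

@[simp] theorem wordStar_cons (c : σ ⊕ σ) (w : List (σ ⊕ σ)) :
    wordStar (c :: w) = wordStar w ++ [c.swap] := by simp [wordStar]

@[simp] theorem wordStar_append (u w : List (σ ⊕ σ)) :
    wordStar (u ++ w) = wordStar w ++ wordStar u := by simp [wordStar]

@[simp] theorem wordStar_wordStar (w : List (σ ⊕ σ)) : wordStar (wordStar w) = w := by
  induction w with
  | nil => rfl
  | cons c w ih => simp [ih]

@[simp] theorem length_wordStar (w : List (σ ⊕ σ)) : (wordStar w).length = w.length := by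
  simp [wordStar]

theorem wordStar_injective : Function.Injective (wordStar (σ := σ)) :=
  Function.LeftInverse.injective wordStar_wordStar

/-- The word `w` as an nc polynomial. -/
noncomputable def word (w : List (σ ⊕ σ)) : NCPoly σ := (w.map (FreeAlgebra.ι ℝ)).prod

@[simp] theorem word_nil : word ([] : List (σ ⊕ σ)) = 1 := rfl

@[simp] theorem word_cons (c : σ ⊕ σ) (w : List (σ ⊕ σ)) :
    word (c :: w) = FreeAlgebra.ι ℝ c * word w := by simp [word]

theorem word_append (u w : List (σ ⊕ σ)) : word (u ++ w) = word u * word w := by simp [word]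

/-- The words form a basis of the nc polynomials. -/
noncomputable def wordBasis (σ : Type) : Module.Basis (List (σ ⊕ σ)) ℝ (NCPoly σ) :=
  (FreeAlgebra.basisFreeMonoid ℝ (σ ⊕ σ)).reindex FreeMonoid.toList

theorem wordBasis_apply (w : List (σ ⊕ σ)) : wordBasis σ w = word w := by
  rw [wordBasis, Module.Basis.reindex_apply, FreeAlgebra.basisFreeMonoid, Module.Basis.map_apply]
  simp only [FreeAlgebra.equivMonoidAlgebraFreeMonoid]
  simp [word, FreeMonoid.lift_apply]

/-- The coefficient of a word in an nc polynomial. -/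
noncomputable def coeff (p : NCPoly σ) : List (σ ⊕ σ) →₀ ℝ := (wordBasis σ).repr p

theorem sum_coeff (p : NCPoly σ) : p = (coeff p).sum fun w r => r • word w := by
  conv_lhs => rw [← (wordBasis σ).linearCombination_repr p]
  simp [Finsupp.linearCombination_apply, wordBasis_apply, coeff]

theorem coeff_word (w : List (σ ⊕ σ)) : coeff (word w) = Finsupp.single w 1 := by
  rw [coeff, ← wordBasis_apply, Module.Basis.repr_self]

theorem transpose_mul (p q : NCPoly σ) : transpose (p * q) = transpose q * transpose p := by
  simp [transpose]

@[simp] theorem transpose_one : transpose (1 : NCPoly σ) = 1 := by simp [transpose]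

theorem transpose_add (p q : NCPoly σ) : transpose (p + q) = transpose p + transpose q := by
  simp [transpose]

theorem transpose_smul (r : ℝ) (p : NCPoly σ) : transpose (r • p) = r • transpose p := by
  simp [transpose]

theorem transpose_sum {ι : Type*} (s : Finset ι) (f : ι → NCPoly σ) :
    transpose (∑ i ∈ s, f i) = ∑ i ∈ s, transpose (f i) := by
  simp [transpose, Finset.unop_sum]

@[simp] theorem transpose_ι (c : σ ⊕ σ) :
    transpose (FreeAlgebra.ι ℝ c : NCPoly σ) = FreeAlgebra.ι ℝ c.swap := by
  cases c <;> simp [transpose, x, xT]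

theorem transpose_word (w : List (σ ⊕ σ)) : transpose (word w) = word (wordStar w) := by
  induction w with
  | nil => simp
  | cons c w ih => simp [transpose_mul, ih, word_append]

theorem transpose_transpose (p : NCPoly σ) : transpose (transpose p) = p := by
  rw [sum_coeff p]
  simp [Finsupp.sum, transpose_sum, transpose_smul, transpose_word]

theorem coeff_transpose (p : NCPoly σ) (w : List (σ ⊕ σ)) :
    coeff (transpose p) w = coeff p (wordStar w) := by
  conv_lhs => rw [sum_coeff p]
  have hadd : ∀ (s : Finset (List (σ ⊕ σ))) (f : List (σ ⊕ σ) → NCPoly σ),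
      coeff (∑ u ∈ s, f u) = ∑ u ∈ s, coeff (f u) := fun s f => by simp [coeff]
  have hsmul : ∀ (r : ℝ) (f : NCPoly σ), coeff (r • f) = r • coeff f := fun s f => by simp [coeff]
  simp only [Finsupp.sum, transpose_sum, transpose_smul, transpose_word, hadd, hsmul, coeff_word,
    Finsupp.coe_finsetSum, Finset.sum_apply, Finsupp.smul_apply]
  rw [Finset.sum_eq_single (wordStar w)]
  · simp
  · intro u _ hu
    rw [Finsupp.single_eq_of_ne, smul_zero]
    rintro rfl
    simp at hu
  · intro h
    simp [Finsupp.notMem_support_iff.mp h]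

theorem IsSymmetric.coeff_wordStar {p : NCPoly σ} (hp : IsSymmetric p) (w : List (σ ⊕ σ)) :
    coeff p (wordStar w) = coeff p w := by
  rw [← coeff_transpose, hp]

/-! ### The complex hessian through Leibniz rules -/

/-- The coefficient of `t ^ a * s ^ b` in `p(x + t h, x^T + s h^T)`. -/
noncomputable def perturbCoeff (a b : ℕ) (p : NCPoly σ) : NCPoly (σ ⊕ σ) :=
  ((perturb p).coeff a).coeff b

theorem complexHessian_eq (p : NCPoly σ) : complexHessian p = perturbCoeff 1 1 p := by
  have h : ∀ {A : Type} [Ring A] (P : Polynomial A),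
      (Polynomial.derivative P).eval 0 = P.coeff 1 := by
    intro A _ P
    rw [← Polynomial.coeff_zero_eq_eval_zero, Polynomial.coeff_derivative]
    simp
  rw [complexHessian, h, h, perturbCoeff]

theorem perturbCoeff_add (a b : ℕ) (p q : NCPoly σ) :
    perturbCoeff a b (p + q) = perturbCoeff a b p + perturbCoeff a b q := by
  simp [perturbCoeff, perturb]

theorem perturbCoeff_smul (a b : ℕ) (r : ℝ) (p : NCPoly σ) :
    perturbCoeff a b (r • p) = r • perturbCoeff a b p := by
  simp [perturbCoeff, perturb]

theorem perturbCoeff_sum (a b : ℕ) {ι : Type*} (s : Finset ι) (f : ι → NCPoly σ) :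
    perturbCoeff a b (∑ i ∈ s, f i) = ∑ i ∈ s, perturbCoeff a b (f i) := by
  simp [perturbCoeff, perturb]

theorem perturbCoeff_zero_zero_mul (p q : NCPoly σ) :
    perturbCoeff 0 0 (p * q) = perturbCoeff 0 0 p * perturbCoeff 0 0 q := by
  simp [perturbCoeff, perturb, Polynomial.coeff_mul]

theorem perturbCoeff_one_zero_mul (p q : NCPoly σ) :
    perturbCoeff 1 0 (p * q) =
      perturbCoeff 0 0 p * perturbCoeff 1 0 q + perturbCoeff 1 0 p * perturbCoeff 0 0 q := by
  simp [perturbCoeff, perturb, Polynomial.coeff_mul, Finset.Nat.antidiagonal_succ]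

theorem perturbCoeff_zero_one_mul (p q : NCPoly σ) :
    perturbCoeff 0 1 (p * q) =
      perturbCoeff 0 0 p * perturbCoeff 0 1 q + perturbCoeff 0 1 p * perturbCoeff 0 0 q := by
  simp [perturbCoeff, perturb, Polynomial.coeff_mul, Finset.Nat.antidiagonal_succ]

theorem perturbCoeff_one_one_mul (p q : NCPoly σ) :
    perturbCoeff 1 1 (p * q) =
      perturbCoeff 0 0 p * perturbCoeff 1 1 q + perturbCoeff 0 1 p * perturbCoeff 1 0 q
      + (perturbCoeff 1 0 p * perturbCoeff 0 1 q
        + perturbCoeff 1 1 p * perturbCoeff 0 0 q) := by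
  simp only [perturbCoeff, perturb, map_mul]
  exact Polynomial.coeff_one_coeff_one_mul _ _

theorem perturbCoeff_algebraMap (r : ℝ) :
    perturbCoeff 0 0 (algebraMap ℝ (NCPoly σ) r) = algebraMap ℝ _ r
    ∧ perturbCoeff 1 0 (algebraMap ℝ (NCPoly σ) r) = 0
    ∧ perturbCoeff 0 1 (algebraMap ℝ (NCPoly σ) r) = 0
    ∧ perturbCoeff 1 1 (algebraMap ℝ (NCPoly σ) r) = 0 := by
  simp [perturbCoeff, perturb, Polynomial.algebraMap_apply, Polynomial.coeff_C]

theorem perturbCoeff_one :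
    perturbCoeff 0 0 (1 : NCPoly σ) = 1 ∧ perturbCoeff 1 0 (1 : NCPoly σ) = 0
    ∧ perturbCoeff 0 1 (1 : NCPoly σ) = 0 ∧ perturbCoeff 1 1 (1 : NCPoly σ) = 0 := by
  simpa using perturbCoeff_algebraMap (σ := σ) 1

theorem perturbCoeff_inl (j : σ) :
    perturbCoeff 0 0 (FreeAlgebra.ι ℝ (.inl j) : NCPoly σ) = x (.inl j)
    ∧ perturbCoeff 1 0 (FreeAlgebra.ι ℝ (.inl j) : NCPoly σ) = x (.inr j)
    ∧ perturbCoeff 0 1 (FreeAlgebra.ι ℝ (.inl j) : NCPoly σ) = 0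
    ∧ perturbCoeff 1 1 (FreeAlgebra.ι ℝ (.inl j) : NCPoly σ) = 0 := by
  simp [perturbCoeff, perturb, Polynomial.coeff_C]

theorem perturbCoeff_inr (j : σ) :
    perturbCoeff 0 0 (FreeAlgebra.ι ℝ (.inr j) : NCPoly σ) = xT (.inl j)
    ∧ perturbCoeff 1 0 (FreeAlgebra.ι ℝ (.inr j) : NCPoly σ) = 0
    ∧ perturbCoeff 0 1 (FreeAlgebra.ι ℝ (.inr j) : NCPoly σ) = xT (.inr j)
    ∧ perturbCoeff 1 1 (FreeAlgebra.ι ℝ (.inr j) : NCPoly σ) = 0 := by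
  simp [perturbCoeff, perturb, Polynomial.coeff_C]

/-- The involution exchanges `h` and `h^T`, hence the roles of `t` and `s`. -/
theorem perturbCoeff_transpose (p : NCPoly σ) :
    perturbCoeff 0 0 (transpose p) = transpose (perturbCoeff 0 0 p)
    ∧ perturbCoeff 0 1 (transpose p) = transpose (perturbCoeff 1 0 p)
    ∧ perturbCoeff 1 0 (transpose p) = transpose (perturbCoeff 0 1 p)
    ∧ perturbCoeff 1 1 (transpose p) = transpose (perturbCoeff 1 1 p) := by
  induction p using FreeAlgebra.induction with
  | grade0 r => simp [perturbCoeff_algebraMap, transpose]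
  | grade1 c =>
    cases c with
    | inl j => simp [perturbCoeff_inl, perturbCoeff_inr, x, xT, transpose]
    | inr j => simp [perturbCoeff_inl, perturbCoeff_inr, x, xT, transpose]
  | mul p q hp hq =>
    obtain ⟨p1, p2, p3, p4⟩ := hp
    obtain ⟨q1, q2, q3, q4⟩ := hq
    simp only [transpose_mul, perturbCoeff_zero_zero_mul, perturbCoeff_one_zero_mul,
      perturbCoeff_zero_one_mul, perturbCoeff_one_one_mul, p1, p2, p3, p4, q1, q2, q3, q4,
      transpose_add]
    refine ⟨trivial, add_comm _ _, add_comm _ _, ?_⟩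
    abel
  | add p q hp hq =>
    obtain ⟨p1, p2, p3, p4⟩ := hp
    obtain ⟨q1, q2, q3, q4⟩ := hq
    simp only [transpose_add, perturbCoeff_add, p1, p2, p3, p4, q1, q2, q3, q4, and_self]

/-- The variable `s` enters only together with `h^T`. This leaves a single Leibniz term in the
hessian of `f^T f` or `k k^T` and none in that of `F + F^T`. -/
theorem IsAnalytic.perturbCoeff {f : NCPoly σ} (hf : IsAnalytic f) :
    perturbCoeff 0 1 f = 0 ∧ perturbCoeff 1 1 f = 0 := by
  induction hf using Algebra.adjoin_induction with
  | mem f hf =>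
    obtain ⟨j, rfl⟩ := hf
    exact ⟨(perturbCoeff_inl j).2.2.1, (perturbCoeff_inl j).2.2.2⟩
  | algebraMap r => exact ⟨(perturbCoeff_algebraMap r).2.2.1, (perturbCoeff_algebraMap r).2.2.2⟩
  | add p q _ _ hp hq => simp [perturbCoeff_add, hp, hq]
  | mul p q _ _ hp hq => simp [perturbCoeff_zero_one_mul, perturbCoeff_one_one_mul, hp, hq]

/-! ### Squares are matrix positive -/

theorem evalMat_transpose {n : ℕ} (X : σ → Matrix (Fin n) (Fin n) ℝ) (p : NCPoly σ) :
    evalMat X (transpose p) = (evalMat X p).transpose := by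
  induction p using FreeAlgebra.induction with
  | grade0 r => simp [transpose, evalMat, Matrix.algebraMap_eq_diagonal]
  | grade1 c => cases c <;> simp [evalMat]
  | mul p q hp hq =>
    rw [transpose_mul]
    simp only [evalMat, map_mul, Matrix.transpose_mul] at *
    rw [hp, hq]
  | add p q hp hq =>
    rw [transpose_add]
    simp only [evalMat, map_add, Matrix.transpose_add] at *
    rw [hp, hq]

theorem matrixPositive_transpose_mul_self (f : NCPoly σ) : MatrixPositive (transpose f * f) := by
  intro n _ X
  have h : evalMat X (transpose f * f) = (evalMat X f).conjTranspose * evalMat X f := by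
    rw [Matrix.conjTranspose_eq_transpose_of_trivial, ← evalMat_transpose]
    simp [evalMat]
  rw [h]
  exact Matrix.posSemidef_conjTranspose_mul_self _

theorem MatrixPositive.add {p q : NCPoly σ} (hp : MatrixPositive p) (hq : MatrixPositive q) :
    MatrixPositive (p + q) := by
  intro n hn X
  have h : evalMat X (p + q) = evalMat X p + evalMat X q := by simp [evalMat]
  rw [h]
  exact (hp n hn X).add (hq n hn X)

theorem matrixPositive_zero : MatrixPositive (0 : NCPoly σ) := by
  intro n _ X
  simpa [evalMat] using Matrix.PosSemidef.zero

theorem matrixPositive_sum {ι : Type*} (s : Finset ι) (f : ι → NCPoly σ)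
    (hf : ∀ i ∈ s, MatrixPositive (f i)) : MatrixPositive (∑ i ∈ s, f i) :=
  Finset.sum_induction f MatrixPositive (fun _ _ => MatrixPositive.add) matrixPositive_zero hf

/-- Sums of hereditary and antihereditary squares and of pluriharmonic terms are
nc plurisubharmonic. -/
theorem isPlush_sum_squares {a b : ℕ} {f : Fin a → NCPoly σ} {k : Fin b → NCPoly σ}
    {F : NCPoly σ} (hf : ∀ j, IsAnalytic (f j)) (hk : ∀ j, IsAnalytic (k j))
    (hF : IsAnalytic F) :
    IsPlush (∑ j, transpose (f j) * f j + ∑ j, k j * transpose (k j) + F + transpose F) := by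
  have hsq : ∀ j, perturbCoeff 1 1 (transpose (f j) * f j)
      = transpose (perturbCoeff 1 0 (f j)) * perturbCoeff 1 0 (f j) := fun j => by
    have h0 : transpose (0 : NCPoly (σ ⊕ σ)) = 0 := by simp [transpose]
    simp [perturbCoeff_one_one_mul, (hf j).perturbCoeff, perturbCoeff_transpose, h0]
  have hsq' : ∀ j, perturbCoeff 1 1 (k j * transpose (k j))
      = transpose (transpose (perturbCoeff 1 0 (k j))) * transpose (perturbCoeff 1 0 (k j)) :=
    fun j => by
      have h0 : transpose (0 : NCPoly (σ ⊕ σ)) = 0 := by simp [transpose]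
      simp [perturbCoeff_one_one_mul, (hk j).perturbCoeff, perturbCoeff_transpose, h0,
        transpose_transpose]
  have h0 : transpose (0 : NCPoly (σ ⊕ σ)) = 0 := by simp [transpose]
  rw [IsPlush, complexHessian_eq]
  simp only [perturbCoeff_add, perturbCoeff_sum, hsq, hsq', perturbCoeff_transpose, hF.perturbCoeff,
    h0, add_zero]
  exact (matrixPositive_sum _ _ fun j _ => matrixPositive_transpose_mul_self _).add
    (matrixPositive_sum _ _ fun j _ => matrixPositive_transpose_mul_self _)

end NCPoly

/-! ### Fock operators and linear independence of words -/

namespace NCPoly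

variable {σ : Type}

/-- The matrices that a matrix tuple assigns to the variables `x_j` and `x_j^T`. -/
def letterMat {m : Type*} (X : σ → Matrix m m ℝ) : σ ⊕ σ → Matrix m m ℝ :=
  Sum.elim X fun j => (X j).transpose

theorem letterMat_swap {m : Type*} (X : σ → Matrix m m ℝ) (c : σ ⊕ σ) :
    letterMat X c.swap = (letterMat X c).transpose := by
  cases c <;> simp [letterMat]

theorem letterMat_add_smul {m : Type*} (X Y : σ → Matrix m m ℝ) (t : ℝ) (c : σ ⊕ σ) :
    letterMat (X + t • Y) c = letterMat X c + t • letterMat Y c := by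
  cases c <;> simp [letterMat]

open Classical in
/-- Truncated creation plus annihilation operators, the words being encoded by `ι`. -/
noncomputable def fockTuple {m : Type*} (d : ℕ) (ι : List (σ ⊕ σ) → m) (j : σ) : Matrix m m ℝ :=
  Matrix.of fun a b =>
    if (∃ w, w.length < d ∧ a = ι (.inl j :: w) ∧ b = ι w) ∨
      (∃ w, w.length < d ∧ b = ι (.inr j :: w) ∧ a = ι w) then 1 else 0

-- Transposition swaps the creation clause with the annihilation clause, so both kinds of letters
-- obey one rule.
open Classical in
theorem letterMat_fockTuple {m : Type*} (d : ℕ) (ι : List (σ ⊕ σ) → m) (c : σ ⊕ σ) (a b : m) :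
    letterMat (fockTuple d ι) c a b =
      if (∃ w, w.length < d ∧ a = ι (c :: w) ∧ b = ι w) ∨
        (∃ w, w.length < d ∧ b = ι (c.swap :: w) ∧ a = ι w) then 1 else 0 := by
  cases c with
  | inl j =>
    simp only [letterMat, fockTuple, Sum.elim_inl, Matrix.of_apply, Sum.swap_inl]
    congr
  | inr j => simp [letterMat, fockTuple, or_comm]

/-- Words in the Fock tuple applied to the vacuum vector are unitriangular in the length. -/
theorem prod_fockTuple [DecidableEq σ] {m : Type*} [Fintype m] [DecidableEq m] {d : ℕ}
    {ι : List (σ ⊕ σ) → m} (hι : Set.InjOn ι {w | w.length ≤ d}) (w : List (σ ⊕ σ))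
    (hw : w.length ≤ d) :
    (∀ a, (w.map (letterMat (fockTuple d ι))).prod a (ι []) ≠ 0 →
      ∃ z : List (σ ⊕ σ), z.length ≤ w.length ∧ a = ι z) ∧
    ∀ z : List (σ ⊕ σ), z.length = w.length →
      (w.map (letterMat (fockTuple d ι))).prod (ι z) (ι []) = if z = w then 1 else 0 := by
  classical
  induction w with
  | nil =>
    refine ⟨fun a ha => ⟨[], le_rfl, ?_⟩, fun z hz => ?_⟩
    · by_contra h
      exact ha (by simp [h])
    · obtain rfl : z = [] := List.length_eq_zero_iff.mp hz
      simp
  | cons c w ih =>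
    simp only [List.length_cons] at hw ⊢
    obtain ⟨ih₁, ih₂⟩ := ih (by omega)
    simp only [List.map_cons, List.prod_cons, Matrix.mul_apply]
    constructor
    · intro a ha
      obtain ⟨b, -, hb⟩ := Finset.exists_ne_zero_of_sum_ne_zero ha
      obtain ⟨u, hu, rfl⟩ := ih₁ b (right_ne_zero_of_mul hb)
      have h := left_ne_zero_of_mul hb
      rw [letterMat_fockTuple] at h
      rcases ite_ne_right_iff.mp h with ⟨⟨v, hv, rfl, huv⟩ | ⟨v, hv, huv, rfl⟩, -⟩
      · have := hι (by simp; omega) (by simp; omega) huv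
        subst this
        exact ⟨c :: u, by simpa using hu, rfl⟩
      · have := hι (by simp; omega) (by simp; omega) huv
        subst this
        simp only [List.length_cons] at hu
        exact ⟨v, by omega, rfl⟩
    · intro z hz
      obtain ⟨c', z', rfl⟩ := List.exists_of_length_succ z hz
      simp only [List.length_cons, add_left_inj] at hz
      -- Only creation can reach the top length: annihilation would need a `u` longer than `w`.
      have key : ∀ u : List (σ ⊕ σ), u.length ≤ w.length →
          letterMat (fockTuple d ι) c (ι (c' :: z')) (ι u) = if c' = c ∧ u = z' then 1 else 0 := by
        intro u hu
        rw [letterMat_fockTuple]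
        refine if_congr ⟨?_, ?_⟩ rfl rfl
        · rintro (⟨v, hv, h₁, h₂⟩ | ⟨v, hv, h₁, h₂⟩)
          · have h₁' := hι (by simp; omega) (by simp; omega) h₁
            have h₂' := hι (by simp; omega) (by simp; omega) h₂
            simp only [List.cons.injEq] at h₁'
            exact ⟨h₁'.1, h₂'.trans h₁'.2.symm⟩
          · have h₁' := congrArg List.length (hι (by simp; omega) (by simp; omega) h₁)
            have h₂' := congrArg List.length (hι (by simp; omega) (by simp; omega) h₂)
            simp only [List.length_cons] at h₁' h₂'
            omega
        · rintro ⟨rfl, rfl⟩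
          exact Or.inl ⟨u, by omega, rfl, rfl⟩
      rw [Finset.sum_eq_single (ι z')]
      · rw [key z' hz.le, ih₂ z' hz]
        by_cases h : c' = c <;> simp [h]
      · intro b _ hb
        by_contra hne
        obtain ⟨u, hu, rfl⟩ := ih₁ b (right_ne_zero_of_mul hne)
        rw [key u hu, if_neg] at hne
        · simp at hne
        · rintro ⟨-, rfl⟩
          exact hb rfl
      · simp

/-- Every nonempty open set of tuples of sufficiently large matrices contains a tuple for which
the words of bounded length applied to a vector admit a dual system. -/
theorem exists_dual_words [Finite σ] [DecidableEq σ] {m : Type*} [Fintype m] [DecidableEq m]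
    {d : ℕ} {ι : List (σ ⊕ σ) → m} (hι : Set.InjOn ι {w | w.length ≤ d})
    {U : Set (σ → Matrix m m ℝ)} (hU : IsOpen U) (hne : U.Nonempty) :
    ∃ X ∈ U, ∃ (v : m → ℝ) (φ : List (σ ⊕ σ) → m → ℝ), ∀ z w : List (σ ⊕ σ),
      z.length ≤ d → w.length ≤ d →
        φ z ⬝ᵥ ((w.map (letterMat X)).prod.mulVec v) = if z = w then 1 else 0 := by
  obtain ⟨X₁, hX₁⟩ := hne
  set Y := fockTuple d ι with hY
  let W : Finset (List (σ ⊕ σ)) := (List.finite_length_le (σ ⊕ σ) d).toFinset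
  have hW : ∀ w, w ∈ W ↔ w.length ≤ d := fun w => by simp [W]
  let T : (σ → Matrix m m ℝ) → Matrix W W ℝ := fun X =>
    Matrix.of fun z w => (w.1.map (letterMat X)).prod (ι z) (ι [])
  -- The determinant of `T` along the line from `X₁` (at `t = 0`) to the Fock tuple `Y` (at `t =
  -- 1`), as a polynomial in `t`.
  let D : Polynomial ℝ := (Matrix.of fun z w : W => (w.1.map fun c =>
    (letterMat X₁ c).map Polynomial.C +
      (Polynomial.X : Polynomial ℝ) • (letterMat (Y - X₁) c).map Polynomial.C).prod
        (ι z) (ι [])).det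
  have hD : ∀ t : ℝ, D.eval t = (T (X₁ + t • (Y - X₁))).det := by
    intro t
    rw [← Polynomial.coe_evalRingHom, RingHom.map_det]
    congr 1
    ext z w
    have h := congrFun (congrFun (map_list_prod (Polynomial.evalRingHom t).mapMatrix
      (w.1.map fun c => (letterMat X₁ c).map Polynomial.C +
      (Polynomial.X : Polynomial ℝ) • (letterMat (Y - X₁) c).map Polynomial.C)) (ι z)) (ι [])
    simp only [RingHom.mapMatrix_apply, Matrix.map_apply] at h
    simp only [RingHom.mapMatrix_apply, Matrix.map_apply, Matrix.of_apply, T]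
    have hfun : (⇑(Polynomial.evalRingHom t).mapMatrix ∘ fun c => (letterMat X₁ c).map Polynomial.C +
        (Polynomial.X : Polynomial ℝ) • (letterMat (Y - X₁) c).map Polynomial.C) =
        letterMat (X₁ + t • (Y - X₁)) := by
      funext c
      rw [letterMat_add_smul]
      ext i j
      simp
      ring
    rw [h, List.map_map, hfun]
  have hdet : (T Y).det ≠ 0 := by
    intro h0
    obtain ⟨r, hr0, hr⟩ := Matrix.exists_mulVec_eq_zero_iff.mpr h0
    obtain ⟨z₀, hz₀⟩ := Function.ne_iff.mp hr0
    -- A kernel vector is tested at a longest word of its support. By unitriangularity only the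
    -- diagonal entry, which is 1, contributes to that row.
    obtain ⟨z, hz, hmax⟩ := Finset.exists_max_image (Finset.univ.filter fun z => r z ≠ 0)
      (fun z => z.1.length) ⟨z₀, by simpa using hz₀⟩
    simp only [Finset.mem_filter, Finset.mem_univ, true_and] at hz hmax
    have hrz := congrFun hr z
    rw [Matrix.mulVec, dotProduct, Finset.sum_eq_single z] at hrz
    · simp only [T, Matrix.of_apply, Pi.zero_apply,
        (prod_fockTuple hι z.1 ((hW _).mp z.2)).2 z.1 rfl, hY] at hrz
      simp at hrz
      exact hz hrz
    · intro w _ hwz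
      by_cases hrw : r w = 0
      · simp [hrw]
      have hle := hmax w hrw
      obtain ⟨h₁, h₂⟩ := prod_fockTuple hι w.1 ((hW _).mp w.2)
      have : T Y z w = 0 := by
        rcases hle.eq_or_lt with heq | hlt
        · simp only [T, Matrix.of_apply]
          rw [h₂ z.1 heq.symm, if_neg]
          exact fun h => hwz (Subtype.ext h.symm)
        · by_contra hne
          obtain ⟨u, hu, hzu⟩ := h₁ _ hne
          have := hι ((hW _).mp z.2) (by have := (hW _).mp w.2; simp; omega) hzu
          rw [this] at hlt
          omega
      rw [this, zero_mul]
    · simp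
  have hD0 : D ≠ 0 := by
    intro h0
    have := hD 1
    rw [h0] at this
    simp at this
    exact hdet this.symm
  have hnhds : {t : ℝ | X₁ + t • (Y - X₁) ∈ U} ∈ nhds 0 := by
    have hc : Continuous fun t : ℝ => X₁ + t • (Y - X₁) := by fun_prop
    exact (hU.preimage hc).mem_nhds (by simpa using hX₁)
  -- Infinitely many `t` near 0 keep the point in `U`, and only finitely many are roots of `D`.
  obtain ⟨t, htU, ht⟩ := (infinite_of_mem_nhds 0 hnhds).exists_notMem_finset D.roots.toFinset
  have hDt : (T (X₁ + t • (Y - X₁))).det ≠ 0 := by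
    rw [← hD]
    simpa [hD0] using ht
  refine ⟨X₁ + t • (Y - X₁), htU, Pi.single (ι []) 1, ?_⟩
  set X := X₁ + t • (Y - X₁)
  have hinv : (T X)⁻¹ * T X = 1 := Matrix.nonsing_inv_mul _ (Ne.isUnit hDt)
  -- The dual system consists of the rows of the inverse of `T X`, placed in the coordinates `ι u`.
  -- Its values at words longer than `d` are irrelevant.
  refine ⟨fun z => if hz : z ∈ W then ∑ u : W, (T X)⁻¹ ⟨z, hz⟩ u • Pi.single (ι u) 1 else 0, ?_⟩
  intro z w hz hw
  have hz' := (hW z).mpr hz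
  have hw' := (hW w).mpr hw
  have h := congrFun (congrFun hinv ⟨z, hz'⟩) ⟨w, hw'⟩
  rw [Matrix.mul_apply, Matrix.one_apply] at h
  simp only [Subtype.mk.injEq] at h
  simp only [dif_pos hz']
  rw [← h, sum_dotProduct]
  refine Finset.sum_congr rfl fun u _ => ?_
  simp [T, smul_dotProduct, Matrix.col_apply]

end NCPoly

/-! ### The quadratic form contributed by a word -/

namespace NCPoly

variable {σ : Type} {m : Type*} [Fintype m]

/-- The vector `∑ z(X) y_v` over all factorizations `w = z v` where `v` starts with a letter of
type `τ`: `true` for the variables `x_j` and `false` for the variables `x_j^T`. -/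
def tailSum (X : σ → Matrix m m ℝ) (y : List (σ ⊕ σ) → m → ℝ) (τ : Bool) :
    List (σ ⊕ σ) → m → ℝ
  | [] => 0
  | c :: w => (letterMat X c).mulVec (tailSum X y τ w) + if c.isLeft = τ then y (c :: w) else 0

/-- The sum `∑ ⟨y_{ua}, z(X) y'_v⟩` over all factorizations `w = u^* z v` with nonempty `u` where
the first letters of `ua` and `v` have the same type. -/
def splitForm (X : σ → Matrix m m ℝ) (y y' : List (σ ⊕ σ) → m → ℝ) :
    List (σ ⊕ σ) → List (σ ⊕ σ) → ℝ
  | _, [] => 0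
  | a, c :: w => splitForm X y y' (c.swap :: a) w +
      y (c.swap :: a) ⬝ᵥ tailSum X y' c.swap.isLeft w

variable (X : σ → Matrix m m ℝ)

theorem tailSum_add (y y' : List (σ ⊕ σ) → m → ℝ) (τ : Bool) (w : List (σ ⊕ σ)) :
    tailSum X (y + y') τ w = tailSum X y τ w + tailSum X y' τ w := by
  induction w with
  | nil => simp [tailSum]
  | cons c w ih =>
    simp only [tailSum, ih, Matrix.mulVec_add]
    split_ifs
    · simp only [Pi.add_apply]; abel
    · simp only [add_zero]

theorem tailSum_smul (r : ℝ) (y : List (σ ⊕ σ) → m → ℝ) (τ : Bool) (w : List (σ ⊕ σ)) :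
    tailSum X (r • y) τ w = r • tailSum X y τ w := by
  induction w with
  | nil => simp [tailSum]
  | cons c w ih =>
    simp only [tailSum, ih, Matrix.mulVec_smul]
    split_ifs
    · simp
    · simp

theorem splitForm_add_left (y₁ y₂ y' : List (σ ⊕ σ) → m → ℝ) (a w : List (σ ⊕ σ)) :
    splitForm X (y₁ + y₂) y' a w = splitForm X y₁ y' a w + splitForm X y₂ y' a w := by
  induction w generalizing a with
  | nil => simp [splitForm]
  | cons c w ih => simp only [splitForm, ih, Pi.add_apply, add_dotProduct]; ring

theorem splitForm_add_right (y y₁ y₂ : List (σ ⊕ σ) → m → ℝ) (a w : List (σ ⊕ σ)) :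
    splitForm X y (y₁ + y₂) a w = splitForm X y y₁ a w + splitForm X y y₂ a w := by
  induction w generalizing a with
  | nil => simp [splitForm]
  | cons c w ih => simp only [splitForm, ih, tailSum_add, dotProduct_add]; ring

theorem splitForm_smul_left (r : ℝ) (y y' : List (σ ⊕ σ) → m → ℝ) (a w : List (σ ⊕ σ)) :
    splitForm X (r • y) y' a w = r * splitForm X y y' a w := by
  induction w generalizing a with
  | nil => simp [splitForm]
  | cons c w ih => simp only [splitForm, ih, Pi.smul_apply, smul_dotProduct, smul_eq_mul]; ring

theorem splitForm_smul_right (r : ℝ) (y y' : List (σ ⊕ σ) → m → ℝ) (a w : List (σ ⊕ σ)) :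
    splitForm X y (r • y') a w = r * splitForm X y y' a w := by
  induction w generalizing a with
  | nil => simp [splitForm]
  | cons c w ih => simp only [splitForm, ih, tailSum_smul, dotProduct_smul, smul_eq_mul]; ring

section Single

variable [DecidableEq σ]

theorem tailSum_single_of_not_isSuffix {v : List (σ ⊕ σ)} (ξ : m → ℝ) (τ : Bool)
    {w : List (σ ⊕ σ)} (h : ¬ v <:+ w) : tailSum X (Pi.single v ξ) τ w = 0 := by
  induction w with
  | nil => rfl
  | cons c w ih =>
    rw [List.suffix_cons_iff, not_or] at h
    rw [tailSum, ih h.2, Pi.single_eq_of_ne (Ne.symm h.1)]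
    simp

theorem tailSum_single_append [DecidableEq m] (c : σ ⊕ σ) (v z : List (σ ⊕ σ)) (ξ : m → ℝ) :
    tailSum X (Pi.single (c :: v) ξ) c.isLeft (z ++ c :: v) =
      (z.map (letterMat X)).prod.mulVec ξ := by
  induction z with
  | nil =>
    rw [List.nil_append, tailSum, tailSum_single_of_not_isSuffix]
    · simp
    · intro h
      simpa using h.length_le
  | cons e z ih =>
    rw [List.cons_append, tailSum, ih, Pi.single_eq_of_ne]
    · simp
    · intro h
      have := congrArg List.length h
      simp at this
      omega

theorem splitForm_single_eq_zero {u : List (σ ⊕ σ)} (η : m → ℝ) (y' : List (σ ⊕ σ) → m → ℝ)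
    {a w : List (σ ⊕ σ)}
    (h : ∀ s w', s ≠ [] → w = wordStar s ++ w' → u ≠ s ++ a) :
    splitForm X (Pi.single u η) y' a w = 0 := by
  induction w generalizing a with
  | nil => rfl
  | cons c w ih =>
    rw [splitForm, ih, Pi.single_eq_of_ne]
    · simp
    · exact fun h' => h [c.swap] w (by simp) (by simp) h'.symm
    · intro s w' _ hw' hu
      exact h (s ++ [c.swap]) w' (by simp) (by simp [hw']) (by simp [hu])

/-- Only the cut at which the reversed prefix spells `c :: u` meets the support of the family. The
accumulator `a` is kept general because the induction removes letters from the end of `s`. -/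
theorem splitForm_single_append (c : σ ⊕ σ) (u : List (σ ⊕ σ)) (η : m → ℝ)
    (y' : List (σ ⊕ σ) → m → ℝ) {s a : List (σ ⊕ σ)} (hs : s ≠ []) (hu : c :: u = s ++ a)
    (w : List (σ ⊕ σ)) :
    splitForm X (Pi.single (c :: u) η) y' a (wordStar s ++ w) = η ⬝ᵥ tailSum X y' c.isLeft w := by
  induction s using List.reverseRecOn generalizing a with
  | nil => exact absurd rfl hs
  | append_singleton s e ih =>
    rw [wordStar_append, wordStar_cons, wordStar_nil, List.nil_append, List.singleton_append,
      List.cons_append, splitForm, Sum.swap_swap]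
    by_cases hs' : s = []
    · subst hs'
      simp only [List.nil_append, List.singleton_append] at hu
      obtain ⟨rfl, rfl⟩ := List.cons.inj hu
      rw [splitForm_single_eq_zero]
      · simp
      · rintro s' - hs'' - h
        simp at h
        exact hs'' h
    · rw [ih hs' (by simpa using hu), Pi.single_eq_of_ne]
      · simp
      · rw [hu]
        intro h
        simp at h
        exact hs' h

end Single

/-! ### Pure words and telescoping families -/

/-- All letters of the word have the type `τ`. -/
def IsPure (τ : Bool) (w : List (σ ⊕ σ)) : Prop := ∀ c ∈ w, c.isLeft = τ

theorem isPure_nil (τ : Bool) : IsPure τ ([] : List (σ ⊕ σ)) := by simp [IsPure]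

theorem isPure_cons {τ : Bool} {c : σ ⊕ σ} {w : List (σ ⊕ σ)} :
    IsPure τ (c :: w) ↔ c.isLeft = τ ∧ IsPure τ w := by simp [IsPure]

theorem isPure_append {τ : Bool} {u w : List (σ ⊕ σ)} :
    IsPure τ (u ++ w) ↔ IsPure τ u ∧ IsPure τ w := by
  simp [IsPure, or_imp, forall_and]

theorem isLeft_swap (c : σ ⊕ σ) : c.swap.isLeft = !c.isLeft := by cases c <;> rfl

theorem isPure_wordStar {τ : Bool} {w : List (σ ⊕ σ)} :
    IsPure τ (wordStar w) ↔ IsPure (!τ) w := by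
  induction w with
  | nil => simp [isPure_nil]
  | cons c w ih =>
    rw [wordStar_cons, isPure_append, ih, isPure_cons, isPure_cons, isLeft_swap]
    simp only [isPure_nil, and_true, Bool.not_eq_eq_eq_not]
    tauto

open Classical in
/-- The family of vectors with `tailSum` equal to `ζ_w e` on words `w` of pure type `τ`. -/
noncomputable def pureFamily (τ : Bool) (ζ : List (σ ⊕ σ) → ℝ) (e : m → ℝ) :
    List (σ ⊕ σ) → m → ℝ
  | [] => 0
  | c :: w => if IsPure τ (c :: w) then ζ (c :: w) • e - ζ w • (letterMat X c).mulVec e else 0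

theorem pureFamily_eq_zero {τ : Bool} {ζ : List (σ ⊕ σ) → ℝ} {e : m → ℝ} {w : List (σ ⊕ σ)}
    (h : ¬ IsPure τ w) : pureFamily X τ ζ e w = 0 := by
  cases w with
  | nil => rfl
  | cons c w => simp [pureFamily, h]

/-- The sum telescopes: the subtracted term in `pureFamily` at `c :: w` cancels `X_c` applied to the
value at `w`. -/
theorem tailSum_pureFamily {τ : Bool} {ζ : List (σ ⊕ σ) → ℝ} (hζ : ζ [] = 0) (e : m → ℝ)
    {w : List (σ ⊕ σ)} (hw : IsPure τ w) : tailSum X (pureFamily X τ ζ e) τ w = ζ w • e := by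
  induction w with
  | nil => simp [tailSum, hζ]
  | cons c w ih =>
    rw [tailSum, ih (isPure_cons.mp hw).2, if_pos (isPure_cons.mp hw).1, pureFamily, if_pos hw,
      Matrix.mulVec_smul]
    abel

theorem tailSum_append_of_isPure [DecidableEq m] {τ : Bool} (y : List (σ ⊕ σ) → m → ℝ)
    {r : List (σ ⊕ σ)} (hr : IsPure (!τ) r) (w : List (σ ⊕ σ)) :
    tailSum X y τ (r ++ w) = (r.map (letterMat X)).prod.mulVec (tailSum X y τ w) := by
  induction r with
  | nil => simp
  | cons c r ih =>
    have hc := (isPure_cons.mp hr).1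
    rw [List.cons_append, tailSum, ih (isPure_cons.mp hr).2, if_neg (by simp [hc])]
    simp

theorem prod_letterMat_wordStar [DecidableEq m] (w : List (σ ⊕ σ)) :
    ((wordStar w).map (letterMat X)).prod = (w.map (letterMat X)).prod.transpose := by
  induction w with
  | nil => simp
  | cons c w ih => simp [ih, letterMat_swap]

theorem dotProduct_prod_wordStar_mulVec [DecidableEq m] (w : List (σ ⊕ σ)) (a b : m → ℝ) :
    a ⬝ᵥ ((wordStar w).map (letterMat X)).prod.mulVec b =
      b ⬝ᵥ (w.map (letterMat X)).prod.mulVec a := by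
  rw [prod_letterMat_wordStar, Matrix.mulVec_transpose, dotProduct_comm, Matrix.dotProduct_mulVec]

theorem splitForm_pureFamily_of_isPure {τ : Bool} (ζ : List (σ ⊕ σ) → ℝ) (e : m → ℝ)
    {w : List (σ ⊕ σ)} (hw : IsPure τ w) (a : List (σ ⊕ σ)) :
    splitForm X (pureFamily X τ ζ e) (pureFamily X τ ζ e) a w = 0 := by
  induction w generalizing a with
  | nil => rfl
  | cons c w ih =>
    have hc := (isPure_cons.mp hw).1
    rw [splitForm, ih (isPure_cons.mp hw).2, pureFamily_eq_zero]
    · simp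
    · rw [isPure_cons, isLeft_swap, hc]
      simp

/-- The same telescoping works from the left. For `a = []` the correction term disappears because `ζ
[] = 0`, which leaves a pure Gram expression. -/
theorem splitForm_pureFamily [DecidableEq m] {τ : Bool} {ζ : List (σ ⊕ σ) → ℝ} (hζ : ζ [] = 0)
    (e : m → ℝ) {s t a : List (σ ⊕ σ)} (hs : IsPure τ s) (ht : IsPure τ t) (ha : IsPure τ a) :
    splitForm X (pureFamily X τ ζ e) (pureFamily X τ ζ e) a (wordStar s ++ t) =
      ζ t * (ζ (s ++ a) * (e ⬝ᵥ e) - ζ a * (e ⬝ᵥ (s.map (letterMat X)).prod.mulVec e)) := by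
  induction s using List.reverseRecOn generalizing a with
  | nil => simp [splitForm_pureFamily_of_isPure X ζ e ht]
  | append_singleton s c ih =>
    rw [isPure_append, isPure_cons] at hs
    obtain ⟨hs, hc, -⟩ := hs
    have hca : IsPure τ (c :: a) := isPure_cons.mpr ⟨hc, ha⟩
    rw [wordStar_append, wordStar_cons, wordStar_nil, List.nil_append, List.singleton_append,
      List.cons_append, splitForm, Sum.swap_swap, ih hs hca, hc,
      tailSum_append_of_isPure X _ (isPure_wordStar.mpr (by simpa using hs)),
      tailSum_pureFamily X hζ e ht, Matrix.mulVec_smul, dotProduct_smul,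
      dotProduct_prod_wordStar_mulVec, pureFamily, if_pos hca]
    simp only [Matrix.mulVec_sub, Matrix.mulVec_smul, dotProduct_sub, dotProduct_smul, smul_eq_mul,
      List.map_append, List.prod_append, List.map_cons, List.map_nil, List.prod_singleton,
      List.append_assoc, List.singleton_append, ← Matrix.mulVec_mulVec]
    ring

/-- Makes the two types independent. A cut inside the starred factor meets the family at a word
starting with the wrong type. A cut inside `t` leaves a tail without letters of type `τ`. -/
theorem splitForm_pureFamily_of_ne {τ : Bool} (ζ : List (σ ⊕ σ) → ℝ) (e : m → ℝ)
    {s t : List (σ ⊕ σ)} (hs : IsPure (!τ) s) (ht : IsPure (!τ) t) (a : List (σ ⊕ σ)) :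
    splitForm X (pureFamily X τ ζ e) (pureFamily X τ ζ e) a (wordStar s ++ t) = 0 := by
  have htail : ∀ w : List (σ ⊕ σ), IsPure (!τ) w → tailSum X (pureFamily X τ ζ e) τ w = 0 := by
    intro w hw
    induction w with
    | nil => rfl
    | cons c w ih =>
      have hc := (isPure_cons.mp hw).1
      rw [tailSum, ih (isPure_cons.mp hw).2, if_neg (by simp [hc])]
      simp
  induction s using List.reverseRecOn generalizing a with
  | nil =>
    simp only [wordStar_nil, List.nil_append]
    induction t generalizing a with
    | nil => rfl
    | cons c t ih =>
      have hc := (isPure_cons.mp ht).1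
      rw [splitForm, ih (isPure_cons.mp ht).2, isLeft_swap, hc, Bool.not_not,
        htail t (isPure_cons.mp ht).2]
      simp
  | append_singleton s c ih =>
    rw [isPure_append, isPure_cons] at hs
    obtain ⟨hs, hc, -⟩ := hs
    rw [wordStar_append, wordStar_cons, wordStar_nil, List.nil_append, List.singleton_append,
      List.cons_append, splitForm, Sum.swap_swap, ih hs, pureFamily_eq_zero]
    · simp
    · simp [isPure_cons, hc]

end NCPoly

/-! ### Evaluating the hessian on a doubled tuple -/

namespace NCPoly

variable {σ : Type}

section Blocks

variable {m : Type*}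

theorem toBlocks₁₁_add (A B : Matrix (m ⊕ m) (m ⊕ m) ℝ) :
    (A + B).toBlocks₁₁ = A.toBlocks₁₁ + B.toBlocks₁₁ := rfl

theorem toBlocks₂₁_add (A B : Matrix (m ⊕ m) (m ⊕ m) ℝ) :
    (A + B).toBlocks₂₁ = A.toBlocks₂₁ + B.toBlocks₂₁ := rfl

variable [Fintype m]

theorem toBlocks₁₁_mul (A B : Matrix (m ⊕ m) (m ⊕ m) ℝ) :
    (A * B).toBlocks₁₁ = A.toBlocks₁₁ * B.toBlocks₁₁ + A.toBlocks₁₂ * B.toBlocks₂₁ := by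
  conv_lhs => rw [← Matrix.fromBlocks_toBlocks A, ← Matrix.fromBlocks_toBlocks B,
    Matrix.fromBlocks_multiply, Matrix.toBlocks_fromBlocks₁₁]

theorem toBlocks₂₁_mul (A B : Matrix (m ⊕ m) (m ⊕ m) ℝ) :
    (A * B).toBlocks₂₁ = A.toBlocks₂₁ * B.toBlocks₁₁ + A.toBlocks₂₂ * B.toBlocks₂₁ := by
  conv_lhs => rw [← Matrix.fromBlocks_toBlocks A, ← Matrix.fromBlocks_toBlocks B,
    Matrix.fromBlocks_multiply, Matrix.toBlocks_fromBlocks₂₁]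

/-- The tuple `X ⊕ X` together with the off-diagonal directions built from `K`. -/
def doubledTuple (X : σ → Matrix m m ℝ) (K : σ ⊕ σ → Matrix m m ℝ) :
    σ ⊕ σ → Matrix (m ⊕ m) (m ⊕ m) ℝ :=
  Sum.elim (fun j => Matrix.fromBlocks (X j) 0 0 (X j))
    fun j => Matrix.fromBlocks 0 (K (.inr j)).transpose (K (.inl j)) 0

variable [DecidableEq m]

/-- The evaluation of an nc polynomial at the doubled tuple. -/
noncomputable def evalDoubled (X : σ → Matrix m m ℝ) (K : σ ⊕ σ → Matrix m m ℝ) :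
    NCPoly (σ ⊕ σ) →ₐ[ℝ] Matrix (m ⊕ m) (m ⊕ m) ℝ :=
  FreeAlgebra.lift ℝ (letterMat (doubledTuple X K))

variable (X : σ → Matrix m m ℝ) (K : σ ⊕ σ → Matrix m m ℝ)

theorem evalDoubled_zero_zero_ι (c : σ ⊕ σ) :
    evalDoubled X K (perturbCoeff 0 0 (FreeAlgebra.ι ℝ c)) =
      Matrix.fromBlocks (letterMat X c) 0 0 (letterMat X c) := by
  cases c with
  | inl j => simp [perturbCoeff_inl, x, evalDoubled, letterMat, doubledTuple]
  | inr j =>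
    simp [perturbCoeff_inr, xT, evalDoubled, letterMat, doubledTuple, Matrix.fromBlocks_transpose]

theorem evalDoubled_one_zero_ι (c : σ ⊕ σ) :
    evalDoubled X K (perturbCoeff 1 0 (FreeAlgebra.ι ℝ c)) =
      if c.isLeft = true then Matrix.fromBlocks 0 (K c.swap).transpose (K c) 0 else 0 := by
  cases c with
  | inl j => simp [perturbCoeff_inl, x, evalDoubled, letterMat, doubledTuple]
  | inr j => simp [perturbCoeff_inr]

theorem evalDoubled_zero_one_ι (c : σ ⊕ σ) :
    evalDoubled X K (perturbCoeff 0 1 (FreeAlgebra.ι ℝ c)) =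
      if c.isLeft = false then Matrix.fromBlocks 0 (K c.swap).transpose (K c) 0 else 0 := by
  cases c with
  | inl j => simp [perturbCoeff_inl]
  | inr j =>
    simp [perturbCoeff_inr, xT, evalDoubled, letterMat, doubledTuple, Matrix.fromBlocks_transpose]

theorem perturbCoeff_one_one_ι (c : σ ⊕ σ) :
    perturbCoeff 1 1 (FreeAlgebra.ι ℝ c : NCPoly σ) = 0 := by
  cases c with
  | inl j => exact (perturbCoeff_inl j).2.2.2
  | inr j => exact (perturbCoeff_inr j).2.2.2

theorem toBlocks₁₁_evalDoubled_zero_zero (w : List (σ ⊕ σ)) :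
    (evalDoubled X K (perturbCoeff 0 0 (word w))).toBlocks₁₁ = (w.map (letterMat X)).prod := by
  induction w with
  | nil =>
    rw [word_nil, perturbCoeff_one.1, map_one, ← Matrix.fromBlocks_one,
      Matrix.toBlocks_fromBlocks₁₁]
    rfl
  | cons c w ih =>
    rw [word_cons, perturbCoeff_zero_zero_mul, map_mul, toBlocks₁₁_mul, ih,
      evalDoubled_zero_zero_ι]
    simp

variable {X K} {d : ℕ} {v : m → ℝ} {y : List (σ ⊕ σ) → m → ℝ}

/-- The single `h`-letter carries the first copy to the second and everything else is block
diagonal. The lower left blocks of `h_j` and `h_j^T` are unrelated, so `y` may be chosen separately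
on the two types. -/
theorem toBlocks₂₁_evalDoubled_mulVec
    (hK : ∀ c w, w.length ≤ d → (K c).mulVec ((w.map (letterMat X)).prod.mulVec v) = y (c :: w))
    {w : List (σ ⊕ σ)} (hw : w.length ≤ d + 1) :
    (evalDoubled X K (perturbCoeff 1 0 (word w))).toBlocks₂₁.mulVec v = tailSum X y true w ∧
    (evalDoubled X K (perturbCoeff 0 1 (word w))).toBlocks₂₁.mulVec v = tailSum X y false w := by
  have h0 : (0 : Matrix (m ⊕ m) (m ⊕ m) ℝ).toBlocks₂₁ = 0 := rfl
  have h0' : (0 : Matrix (m ⊕ m) (m ⊕ m) ℝ).toBlocks₂₂ = 0 := rfl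
  induction w with
  | nil => simp [perturbCoeff_one, tailSum, h0]
  | cons c w ih =>
    simp only [List.length_cons, add_le_add_iff_right] at hw
    obtain ⟨ih₁, ih₂⟩ := ih (by omega)
    rw [word_cons, perturbCoeff_one_zero_mul, perturbCoeff_zero_one_mul]
    simp only [map_add, map_mul, toBlocks₂₁_add, toBlocks₂₁_mul, evalDoubled_zero_zero_ι,
      evalDoubled_one_zero_ι, evalDoubled_zero_one_ι, toBlocks₁₁_evalDoubled_zero_zero,
      Matrix.toBlocks_fromBlocks₂₁, Matrix.toBlocks_fromBlocks₂₂, Matrix.add_mulVec, zero_mul,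
      zero_add, ← Matrix.mulVec_mulVec, ih₁, ih₂, tailSum]
    constructor <;> split_ifs <;> simp [h0, h0', hK c w hw]

/-- One `h`-letter moves to the second copy and the other returns. The returning block is `(K
c.swap)^T`; moved to the left vector, it produces `y (c.swap :: a)`, where `a` is the starred prefix
already read. -/
theorem dotProduct_toBlocks₁₁_evalDoubled
    (hK : ∀ c w, w.length ≤ d → (K c).mulVec ((w.map (letterMat X)).prod.mulVec v) = y (c :: w))
    {a w : List (σ ⊕ σ)} (hw : a.length + w.length ≤ d + 1) :
    ((a.map (letterMat X)).prod.mulVec v) ⬝ᵥ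
      ((evalDoubled X K (perturbCoeff 1 1 (word w))).toBlocks₁₁.mulVec v) =
        splitForm X y y a w := by
  have h0 : (0 : Matrix (m ⊕ m) (m ⊕ m) ℝ).toBlocks₁₁ = 0 := rfl
  have h0' : (0 : Matrix (m ⊕ m) (m ⊕ m) ℝ).toBlocks₁₂ = 0 := rfl
  have hadj : ∀ (A : Matrix m m ℝ) (u u' : m → ℝ), u ⬝ᵥ A.transpose.mulVec u' =
      A.mulVec u ⬝ᵥ u' := fun A u u' => by
    rw [Matrix.mulVec_transpose, dotProduct_comm, ← Matrix.dotProduct_mulVec, dotProduct_comm]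
  induction w generalizing a with
  | nil => simp [perturbCoeff_one, splitForm, h0]
  | cons c w ih =>
    simp only [List.length_cons] at hw
    obtain ⟨h₁, h₂⟩ := toBlocks₂₁_evalDoubled_mulVec hK (w := w) (by omega)
    have ih' := ih (a := c.swap :: a) (by simp; omega)
    rw [splitForm, ← ih', ← hK c.swap a (by omega), word_cons, perturbCoeff_one_one_mul,
      perturbCoeff_one_one_ι]
    rw [List.map_cons, List.prod_cons, ← Matrix.mulVec_mulVec, letterMat_swap]
    generalize (a.map (letterMat X)).prod.mulVec v = u
    rw [← hadj (letterMat X c).transpose, Matrix.transpose_transpose, ← hadj (K c.swap)]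
    simp only [map_add, map_mul, toBlocks₁₁_add, toBlocks₁₁_mul, evalDoubled_zero_zero_ι,
      evalDoubled_one_zero_ι, evalDoubled_zero_one_ι,
      Matrix.toBlocks_fromBlocks₁₁, Matrix.toBlocks_fromBlocks₁₂, Matrix.add_mulVec, zero_mul,
      add_zero, ← Matrix.mulVec_mulVec]
    rw [isLeft_swap]
    rcases hc : c.isLeft
    · simp [h₁, h0, h0', dotProduct_add]
    · simp [h₂, h0, h0', dotProduct_add]

theorem dotProduct_toBlocks₁₁_evalDoubled_complexHessian
    (hK : ∀ c w, w.length ≤ d → (K c).mulVec ((w.map (letterMat X)).prod.mulVec v) = y (c :: w))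
    {p : NCPoly σ} (hp : ∀ w ∈ (coeff p).support, w.length ≤ d) :
    v ⬝ᵥ ((evalDoubled X K (complexHessian p)).toBlocks₁₁.mulVec v) =
      (coeff p).sum fun w r => r * splitForm X y y [] w := by
  let Λ : Matrix (m ⊕ m) (m ⊕ m) ℝ →ₗ[ℝ] ℝ :=
    { toFun := fun A => v ⬝ᵥ A.toBlocks₁₁.mulVec v
      map_add' := fun A B => by rw [toBlocks₁₁_add, Matrix.add_mulVec, dotProduct_add]
      map_smul' := fun r A => by
        have : (r • A).toBlocks₁₁ = r • A.toBlocks₁₁ := rfl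
        rw [this, Matrix.smul_mulVec, dotProduct_smul, RingHom.id_apply] }
  change Λ (evalDoubled X K (complexHessian p)) = _
  conv_lhs => rw [sum_coeff p]
  rw [complexHessian_eq]
  simp only [Finsupp.sum, perturbCoeff_sum, perturbCoeff_smul, map_sum, map_smul, smul_eq_mul]
  refine Finset.sum_congr rfl fun w hw => ?_
  congr 1
  have h := dotProduct_toBlocks₁₁_evalDoubled hK (a := []) (w := w)
    (by have := hp w hw; simp; omega)
  rw [List.map_nil, List.prod_nil, Matrix.one_mulVec] at h
  exact h

end Blocks

/-- The identification of two copies of an index set with the disjoint union over `Fin 2`. -/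
def sumEquivSigmaFinTwo (α : Type*) : α ⊕ α ≃ (_ : Fin 2) × α where
  toFun := Sum.elim (fun a => ⟨0, a⟩) fun a => ⟨1, a⟩
  invFun := fun i => if i.1 = 0 then .inl i.2 else .inr i.2
  left_inv := by rintro (a | a) <;> simp
  right_inv := by
    rintro ⟨j, a⟩
    fin_cases j <;> simp

theorem directSumTuple_fin_two {n : ℕ} (X : σ → Matrix (Fin n) (Fin n) ℝ) (i : σ) :
    directSumTuple (fun _ : Fin 2 => X) i =
      (Matrix.fromBlocks (X i) 0 0 (X i)).reindex
        ((sumEquivSigmaFinTwo (Fin n)).trans finSigmaFinEquiv)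
        ((sumEquivSigmaFinTwo (Fin n)).trans finSigmaFinEquiv) := by
  have h : Matrix.blockDiagonal' (fun _ : Fin 2 => X i) =
      (Matrix.fromBlocks (X i) 0 0 (X i)).reindex (sumEquivSigmaFinTwo (Fin n))
        (sumEquivSigmaFinTwo (Fin n)) := by
    ext ⟨j, a⟩ ⟨k, b⟩
    fin_cases j <;> fin_cases k <;> simp [sumEquivSigmaFinTwo, Matrix.blockDiagonal'_apply]
  rw [directSumTuple, h]
  rfl

/-- Only membership of `X ⊕ X` in `G` is needed, since the direction may be any matrix tuple. -/
theorem posSemidef_evalDoubled {p : NCPoly σ} {G : (n : ℕ) → Set (σ → Matrix (Fin n) (Fin n) ℝ)}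
    (hG : RespectsDirectSums G) (hplush : IsPlushOn G p) {n : ℕ} (hn : 1 ≤ n)
    {X : σ → Matrix (Fin n) (Fin n) ℝ} (hX : X ∈ G n)
    (K : σ ⊕ σ → Matrix (Fin n) (Fin n) ℝ) :
    (evalDoubled X K (complexHessian p)).PosSemidef := by
  let e : Fin n ⊕ Fin n ≃ Fin (∑ _ : Fin 2, n) :=
    (sumEquivSigmaFinTwo (Fin n)).trans finSigmaFinEquiv
  have hDS := hG 2 (fun _ => n) (by norm_num) (fun _ => hn) (fun _ => X) fun _ => hX
  have h := hplush _ (by simp; omega) _ hDS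
    fun j => (doubledTuple X K (.inr j)).reindex e e
  have heval : ∀ q : NCPoly (σ ⊕ σ),
      evalMat (Sum.elim (directSumTuple fun _ : Fin 2 => X)
        fun j => (doubledTuple X K (.inr j)).reindex e e) q =
        (evalDoubled X K q).reindex e e := by
    intro q
    have hhom : FreeAlgebra.lift ℝ (letterMat (Sum.elim (directSumTuple fun _ : Fin 2 => X)
        fun j => (doubledTuple X K (.inr j)).reindex e e)) =
        ((Matrix.reindexAlgEquiv ℝ ℝ e).toAlgHom.comp (evalDoubled X K)) := by
      apply FreeAlgebra.hom_ext
      funext c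
      rcases c with (j | j) | (j | j) <;>
        simp [evalDoubled, letterMat, directSumTuple_fin_two, doubledTuple, e,
          ← Matrix.transpose_submatrix]
    exact congrArg (fun f => f q) hhom
  rw [heval] at h
  have h' := h.submatrix e
  simpa using h'

variable [Fintype σ] [DecidableEq σ]

/-- Positivity of the complex hessian on a direct sum `X ⊕ X`, expressed through arbitrary
families of vectors indexed by words. -/
theorem sum_splitForm_nonneg {p : NCPoly σ}
    {G : (n : ℕ) → Set (σ → Matrix (Fin n) (Fin n) ℝ)}
    (hG : RespectsDirectSums G) (hplush : IsPlushOn G p) {n : ℕ} (hn : 1 ≤ n)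
    {X : σ → Matrix (Fin n) (Fin n) ℝ} (hX : X ∈ G n) {d : ℕ}
    (hp : ∀ w ∈ (coeff p).support, w.length ≤ d) {v : Fin n → ℝ}
    {φ : List (σ ⊕ σ) → Fin n → ℝ} (hφ : ∀ z w : List (σ ⊕ σ), z.length ≤ d → w.length ≤ d →
      φ z ⬝ᵥ ((w.map (letterMat X)).prod.mulVec v) = if z = w then 1 else 0)
    (y : List (σ ⊕ σ) → Fin n → ℝ) :
    0 ≤ (coeff p).sum fun w r => r * splitForm X y y [] w := by
  let W : Finset (List (σ ⊕ σ)) := (List.finite_length_le (σ ⊕ σ) d).toFinset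
  have hW : ∀ w, w ∈ W ↔ w.length ≤ d := fun w => by simp [W]
  -- Interpolation by the dual system: `K c` sends `w(X) v` to `y (c :: w)` for all words of length
  -- at most `d` at once.
  let K : σ ⊕ σ → Matrix (Fin n) (Fin n) ℝ := fun c =>
    ∑ z ∈ W, Matrix.vecMulVec (y (c :: z)) (φ z)
  have hK : ∀ c w, w.length ≤ d →
      (K c).mulVec ((w.map (letterMat X)).prod.mulVec v) = y (c :: w) := by
    intro c w hw
    simp only [K, Matrix.sum_mulVec, Matrix.vecMulVec_mulVec]
    rw [Finset.sum_eq_single w]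
    · rw [hφ w w hw hw]
      simp
    · intro z hz hzw
      rw [hφ z w ((hW z).mp hz) hw, if_neg hzw]
      simp
    · intro h
      exact absurd ((hW w).mpr hw) h
  rw [← dotProduct_toBlocks₁₁_evalDoubled_complexHessian hK hp]
  exact ((posSemidef_evalDoubled hG hplush hn hX K).submatrix Sum.inl).dotProduct_mulVec_nonneg v

end NCPoly

/-! ### Restricting the support of `p` -/

namespace NCPoly

section Support

variable {σ : Type} {m : Type*} [Fintype m] [DecidableEq m] [DecidableEq σ]
  (X : σ → Matrix m m ℝ)

theorem splitForm_single_single {c e : σ ⊕ σ} (h : c.isLeft = e.isLeft) (u v z : List (σ ⊕ σ))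
    (η ξ : m → ℝ) :
    splitForm X (Pi.single (c :: u) η) (Pi.single (e :: v) ξ) []
      (wordStar (c :: u) ++ (z ++ e :: v)) = η ⬝ᵥ (z.map (letterMat X)).prod.mulVec ξ := by
  rw [splitForm_single_append X c u η _ (List.cons_ne_nil c u) (by simp), h, tailSum_single_append]

omit [DecidableEq m] in
theorem splitForm_single_single_eq_zero (c : σ ⊕ σ) (u v : List (σ ⊕ σ)) (η ξ : m → ℝ)
    {w : List (σ ⊕ σ)} (h : ∀ z, w ≠ wordStar (c :: u) ++ (z ++ v)) :
    splitForm X (Pi.single (c :: u) η) (Pi.single v ξ) [] w = 0 := by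
  by_cases hw : ∃ w', w = wordStar (c :: u) ++ w'
  · obtain ⟨w', rfl⟩ := hw
    rw [splitForm_single_append X c u η _ (List.cons_ne_nil c u) (by simp),
      tailSum_single_of_not_isSuffix, dotProduct_zero]
    rintro ⟨z, rfl⟩
    exact h z rfl
  · apply splitForm_single_eq_zero
    intro s w' _ hw' hs
    rw [List.append_nil] at hs
    subst hs
    exact hw ⟨w', hw'⟩

variable {X} {p : NCPoly σ} {d : ℕ} {v₀ : m → ℝ} {φ : List (σ ⊕ σ) → m → ℝ}

/-- If a diagonal entry of the middle matrix vanishes, then so do all entries of its column. -/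
theorem IsSymmetric.coeff_eq_zero_of_diagonal (hsymm : IsSymmetric p)
    (hp : ∀ w ∈ (coeff p).support, w.length ≤ d)
    (hφ : ∀ z w : List (σ ⊕ σ), z.length ≤ d → w.length ≤ d →
      φ z ⬝ᵥ ((w.map (letterMat X)).prod.mulVec v₀) = if z = w then 1 else 0)
    (hQ : ∀ y : List (σ ⊕ σ) → m → ℝ,
      0 ≤ (coeff p).sum fun w r => r * splitForm X y y [] w)
    {c e : σ ⊕ σ} {u v : List (σ ⊕ σ)} (hce : c.isLeft = e.isLeft)
    (hv : ∀ z, coeff p (wordStar (e :: v) ++ (z ++ e :: v)) = 0) (z : List (σ ⊕ σ)) :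
    coeff p (wordStar (c :: u) ++ (z ++ e :: v)) = 0 := by
  by_contra hne
  have hz : z.length ≤ d := by
    have := hp _ (Finsupp.mem_support_iff.mpr hne)
    simp at this
    omega
  set w₁ := wordStar (c :: u) ++ (z ++ e :: v) with hw₁
  set w₂ := wordStar (e :: v) ++ (wordStar z ++ c :: u) with hw₂
  have hw₁₂ : w₂ = wordStar w₁ := by simp [hw₁, hw₂]
  have hle : ∀ {z' : List (σ ⊕ σ)} {w}, w ∈ (coeff p).support →
      (∃ a b : List (σ ⊕ σ), w = a ++ (z' ++ b)) → z'.length ≤ d := by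
    rintro z' w hw ⟨a, b, rfl⟩
    have := hp _ hw
    simp at this
    omega
  -- The vectors `φ z` and `v₀` are dual, so the cross terms of `U` and `V` isolate the middle word
  -- `z`. The `V`-`V` term vanishes by `hv`, so the form at `U + s • V` is affine in `s`.
  set U : List (σ ⊕ σ) → m → ℝ := Pi.single (c :: u) (φ z)
  set V : List (σ ⊕ σ) → m → ℝ := Pi.single (e :: v) v₀
  have hVV : ∀ w ∈ (coeff p).support, splitForm X V V [] w = 0 := by
    intro w hw
    apply splitForm_single_single_eq_zero
    rintro z' rfl
    exact Finsupp.mem_support_iff.mp hw (hv z')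
  have hUV : ∀ w ∈ (coeff p).support, splitForm X U V [] w = if w = w₁ then 1 else 0 := by
    intro w hw
    by_cases h : ∃ z', w = wordStar (c :: u) ++ (z' ++ e :: v)
    · obtain ⟨z', rfl⟩ := h
      rw [splitForm_single_single X hce, hφ z z' hz (hle hw ⟨_, _, rfl⟩)]
      simp [hw₁, eq_comm]
    · push Not at h
      rw [splitForm_single_single_eq_zero X _ _ _ _ _ h, if_neg (h z)]
  have hVU : ∀ w ∈ (coeff p).support, splitForm X V U [] w = if w = w₂ then 1 else 0 := by
    intro w hw
    by_cases h : ∃ z', w = wordStar (e :: v) ++ (z' ++ c :: u)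
    · obtain ⟨z', rfl⟩ := h
      rw [splitForm_single_single X hce.symm, ← wordStar_wordStar z',
        dotProduct_prod_wordStar_mulVec, hφ z _ hz (by simpa using hle hw ⟨_, _, rfl⟩)]
      rw [wordStar_wordStar]
      refine if_congr ⟨?_, ?_⟩ rfl rfl
      · rintro rfl
        simp [hw₂]
      · intro h
        rw [hw₂, List.append_cancel_left_eq, List.append_cancel_right_eq] at h
        rw [h, wordStar_wordStar]
    · push Not at h
      rw [splitForm_single_single_eq_zero X _ _ _ _ _ h, if_neg (h _)]
  have hsum : ∀ s : ℝ, ((coeff p).sum fun w r => r * splitForm X (U + s • V) (U + s • V) [] w) =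
      ((coeff p).sum fun w r => r * splitForm X U U [] w) + s * (2 * coeff p w₁) := by
    intro s
    have h₁ : ∑ w ∈ (coeff p).support, coeff p w * (if w = w₁ then 1 else 0) = coeff p w₁ := by
      simp [hne]
    have h₂ : ∑ w ∈ (coeff p).support, coeff p w * (if w = w₂ then 1 else 0) = coeff p w₁ := by
      rw [← hsymm.coeff_wordStar w₁, ← hw₁₂]
      simpa using fun h => Eq.symm h
    rw [two_mul]
    nth_rw 1 [← h₁]
    rw [← h₂, ← Finset.sum_add_distrib, Finset.mul_sum, Finsupp.sum, Finsupp.sum,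
      ← Finset.sum_add_distrib]
    refine Finset.sum_congr rfl fun w hw => ?_
    rw [← hUV w hw, ← hVU w hw]
    simp only [splitForm_add_left, splitForm_add_right, splitForm_smul_left, splitForm_smul_right,
      hVV w hw]
    ring
  set A := (coeff p).sum fun w r => r * splitForm X U U [] w
  -- This value of `s` makes the affine function equal to `A - |A| - 1`, which is negative.
  have h := hQ (U + (-(|A| + 1) / (2 * coeff p w₁)) • V)
  rw [hsum, div_mul_cancel₀ _ (mul_ne_zero two_ne_zero hne)] at h
  linarith [le_abs_self A]

omit [DecidableEq σ] in
theorem exists_isLeft_ne_of_not_isPure {w : List (σ ⊕ σ)} (h : ∀ τ, ¬ IsPure τ w) :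
    ∃ e z c a, w = e :: z ++ c :: a ∧ e.isLeft ≠ c.isLeft := by
  cases w with
  | nil => exact absurd (isPure_nil true) (h true)
  | cons e w =>
    have h' := h e.isLeft
    rw [isPure_cons, IsPure] at h'
    push Not at h'
    obtain ⟨c, hc, hce⟩ := h' rfl
    obtain ⟨z, a, rfl⟩ := List.append_of_mem hc
    exact ⟨e, z, c, a, rfl, hce.symm⟩

omit [DecidableEq σ] in
/-- A word changes the type of its letters at most once, or there is a change of type after which
both types still occur. -/
theorem exists_isPure_or_exists_not_isPure (w : List (σ ⊕ σ)) :
    (∃ τ s t, IsPure τ s ∧ IsPure τ t ∧ w = wordStar s ++ t) ∨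
      ∃ e z c a, w = e :: z ++ c :: a ∧ e.isLeft ≠ c.isLeft ∧ ∀ τ, ¬ IsPure τ (c :: a) := by
  cases w with
  | nil => exact Or.inl ⟨true, [], [], isPure_nil _, isPure_nil _, rfl⟩
  | cons e w =>
    have key : ∀ w : List (σ ⊕ σ), IsPure e.isLeft w ∨
        ∃ z c a, w = z ++ c :: a ∧ IsPure e.isLeft z ∧ e.isLeft ≠ c.isLeft := by
      intro w
      induction w with
      | nil => exact Or.inl (isPure_nil _)
      | cons f w ih =>
        by_cases hf : f.isLeft = e.isLeft
        · rcases ih with ih | ⟨z, c, a, rfl, hz, hc⟩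
          · exact Or.inl (isPure_cons.mpr ⟨hf, ih⟩)
          · exact Or.inr ⟨f :: z, c, a, rfl, isPure_cons.mpr ⟨hf, hz⟩, hc⟩
        · exact Or.inr ⟨[], f, w, rfl, isPure_nil _, Ne.symm hf⟩
    rcases key w with hw | ⟨z, c, a, rfl, hz, hc⟩
    · exact Or.inl ⟨e.isLeft, [], e :: w, isPure_nil _, isPure_cons.mpr ⟨rfl, hw⟩, rfl⟩
    · by_cases hca : ∃ τ, IsPure τ (c :: a)
      · obtain ⟨τ, hτ⟩ := hca
        refine Or.inl ⟨τ, wordStar (e :: z), c :: a, ?_, hτ, by simp⟩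
        have hcτ := (isPure_cons.mp hτ).1
        rw [isPure_wordStar, isPure_cons]
        have : (!τ) = e.isLeft := by
          rw [← hcτ]
          revert hc
          cases e.isLeft <;> cases c.isLeft <;> simp
        exact ⟨this.symm, this ▸ hz⟩
      · push Not at hca
        exact Or.inr ⟨e, z, c, a, rfl, hc, hca⟩

/-- The words in the support change the type of their letters at most once. -/
theorem IsSymmetric.exists_isPure_of_mem_support (hsymm : IsSymmetric p)
    (hp : ∀ w ∈ (coeff p).support, w.length ≤ d)
    (hφ : ∀ z w : List (σ ⊕ σ), z.length ≤ d → w.length ≤ d →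
      φ z ⬝ᵥ ((w.map (letterMat X)).prod.mulVec v₀) = if z = w then 1 else 0)
    (hQ : ∀ y : List (σ ⊕ σ) → m → ℝ,
      0 ≤ (coeff p).sum fun w r => r * splitForm X y y [] w)
    {w : List (σ ⊕ σ)} (hw : w ∈ (coeff p).support) :
    ∃ τ s t, IsPure τ s ∧ IsPure τ t ∧ w = wordStar s ++ t := by
  refine (exists_isPure_or_exists_not_isPure w).resolve_right ?_
  rintro ⟨e, z, c, a, rfl, hec, hca⟩
  -- From one bad word a bad word with a longer tail is produced, which eventually exceeds the
  -- degree bound.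
  have key : ∀ k : ℕ, ∃ e z c a, e :: z ++ c :: a ∈ (coeff p).support ∧ e.isLeft ≠ c.isLeft ∧
      (∀ τ, ¬ IsPure τ (c :: a)) ∧ k ≤ a.length := by
    intro k
    induction k with
    | zero => exact ⟨e, z, c, a, hw, hec, hca, Nat.zero_le _⟩
    | succ k ih =>
      obtain ⟨e, z, c, a, hw, hec, hca, hk⟩ := ih
      have h : ∃ z', coeff p (wordStar (c :: a) ++ (z' ++ c :: a)) ≠ 0 := by
        by_contra! h
        refine Finsupp.mem_support_iff.mp hw ?_
        have hce : e.swap.isLeft = c.isLeft := by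
          rw [isLeft_swap]
          revert hec
          cases e.isLeft <;> cases c.isLeft <;> simp
        -- The row is the one-letter word `e.swap`, whose star is the first letter `e`; its type
        -- agrees with that of `c`.
        simpa using hsymm.coeff_eq_zero_of_diagonal hp hφ hQ (u := []) hce h z
      obtain ⟨z', hz'⟩ := h
      -- The next change of type is taken inside the starred prefix, so the new tail contains all of
      -- `c :: a` and is again impure.
      obtain ⟨e', r, c', a', hr, hec'⟩ := exists_isLeft_ne_of_not_isPure
        (w := wordStar (c :: a)) fun τ h => hca _ (isPure_wordStar.mp h)
      refine ⟨e', r, c', a' ++ (z' ++ c :: a), ?_, hec', fun τ h => hca τ ?_, ?_⟩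
      · rw [hr] at hz'
        simpa using hz'
      · rw [← List.cons_append, isPure_append, isPure_append] at h
        exact h.2.2
      · simp
        omega
  obtain ⟨e, z, c, a, hw, -, -, hk⟩ := key (d + 1)
  have := hp _ hw
  simp at this
  omega

end Support

end NCPoly

/-! ### Gram matrices and the decomposition -/

namespace NCPoly

variable {σ : Type}

theorem IsPure.filter_append {τ : Bool} {r t : List (σ ⊕ σ)} (hr : IsPure (!τ) r)
    (ht : IsPure τ t) : (r ++ t).filter (fun c => c.isLeft == τ) = t := by
  rw [List.filter_append, List.filter_eq_nil_iff.mpr, List.filter_eq_self.mpr, List.nil_append]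
  · intro c hc
    simp [ht c hc]
  · intro c hc
    simp [hr c hc]

/-- The factor `t` consists of the letters of type `τ`, so filtering by type recovers the
factorization. -/
theorem wordStar_append_inj {τ : Bool} {s t s' t' : List (σ ⊕ σ)} (hs : IsPure τ s)
    (ht : IsPure τ t) (hs' : IsPure τ s') (ht' : IsPure τ t')
    (h : wordStar s ++ t = wordStar s' ++ t') : s = s' ∧ t = t' := by
  have h₁ := IsPure.filter_append (isPure_wordStar.mpr (by simpa using hs)) ht
  have h₂ := IsPure.filter_append (isPure_wordStar.mpr (by simpa using hs')) ht'
  have htt : t = t' := by rw [← h₁, h, h₂]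
  subst htt
  exact ⟨wordStar_injective (List.append_cancel_right h), rfl⟩

variable [Fintype σ]

open Classical in
/-- The nonempty words of length at most `d` all of whose letters have the type `τ`. -/
noncomputable def pureWords (σ : Type) [Fintype σ] (d : ℕ) (τ : Bool) : Finset (List (σ ⊕ σ)) :=
  (List.finite_length_le (σ ⊕ σ) d).toFinset.filter fun w => w ≠ [] ∧ IsPure τ w

theorem mem_pureWords {d : ℕ} {τ : Bool} {w : List (σ ⊕ σ)} :
    w ∈ pureWords σ d τ ↔ w.length ≤ d ∧ w ≠ [] ∧ IsPure τ w := by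
  simp [pureWords]

theorem wordStar_mem_pureWords {d : ℕ} {τ : Bool} {w : List (σ ⊕ σ)} :
    wordStar w ∈ pureWords σ d τ ↔ w ∈ pureWords σ d (!τ) := by
  rw [mem_pureWords, mem_pureWords, length_wordStar, isPure_wordStar, Ne, Ne, ← wordStar_nil,
    wordStar_injective.eq_iff, wordStar_nil]

/-- A sum over a polynomial whose words change type at most once, sorted by the form of words. -/
theorem sum_coeff_eq_of_isPure {p : NCPoly σ} {d : ℕ}
    (hp : ∀ w ∈ (coeff p).support, w.length ≤ d)
    (hpure : ∀ w ∈ (coeff p).support, ∃ τ s t, IsPure τ s ∧ IsPure τ t ∧ w = wordStar s ++ t)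
    {E : Type*} [AddCommMonoid E] [Module ℝ E] (f : List (σ ⊕ σ) → E) (τ : Bool) :
    ((coeff p).sum fun w r => r • f w) =
      (∑ s ∈ pureWords σ d τ, ∑ t ∈ pureWords σ d τ,
        coeff p (wordStar s ++ t) • f (wordStar s ++ t))
      + (∑ s ∈ pureWords σ d (!τ), ∑ t ∈ pureWords σ d (!τ),
        coeff p (wordStar s ++ t) • f (wordStar s ++ t))
      + ∑ s ∈ pureWords σ d τ, coeff p s • f s
      + ∑ s ∈ pureWords σ d (!τ), coeff p s • f s
      + coeff p [] • f [] := by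
  classical
  let U : Bool → Finset (List (σ ⊕ σ)) := fun τ =>
    (pureWords σ d τ ×ˢ pureWords σ d τ).image fun st => wordStar st.1 ++ st.2
  have hU : ∀ τ, ∑ w ∈ U τ, coeff p w • f w = ∑ s ∈ pureWords σ d τ, ∑ t ∈ pureWords σ d τ,
        coeff p (wordStar s ++ t) • f (wordStar s ++ t) := by
    intro τ
    rw [Finset.sum_image, Finset.sum_product]
    rintro ⟨s, t⟩ h ⟨s', t'⟩ h' heq
    simp only [Finset.coe_product, Set.mem_prod, Finset.mem_coe, mem_pureWords] at h h'
    obtain ⟨h₁, h₂⟩ := wordStar_append_inj h.1.2.2 h.2.2.2 h'.1.2.2 h'.2.2.2 heq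
    exact Prod.ext h₁ h₂
  have hmemU : ∀ {τ w}, w ∈ U τ → ∃ c w' e w'', w = c :: (w' ++ e :: w'') ∧ c.isLeft = (!τ) ∧
      e.isLeft = τ := by
    intro τ w hw
    simp only [U, Finset.mem_image, Finset.mem_product, Prod.exists] at hw
    obtain ⟨s, t, ⟨hs, ht⟩, rfl⟩ := hw
    have hs' : wordStar s ∈ pureWords σ d (!τ) := wordStar_mem_pureWords.mpr (by simpa using hs)
    rw [mem_pureWords] at hs' ht
    obtain ⟨c, w', hc⟩ := List.exists_cons_of_ne_nil hs'.2.1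
    obtain ⟨e, w'', rfl⟩ := List.exists_cons_of_ne_nil ht.2.1
    refine ⟨c, w', e, w'', by rw [hc, List.cons_append], ?_, (isPure_cons.mp ht.2.2).1⟩
    have := hs'.2.2
    rw [hc] at this
    exact (isPure_cons.mp this).1
  have hdU : Disjoint (U τ) (U (!τ)) := by
    rw [Finset.disjoint_left]
    intro w h h'
    obtain ⟨c, _, _, _, rfl, hc, -⟩ := hmemU h
    obtain ⟨c', _, _, _, heq, hc', -⟩ := hmemU h'
    rw [(List.cons.inj heq).1, hc'] at hc
    simp at hc
  have hdUW : ∀ τ τ', Disjoint (U τ) (pureWords σ d τ') := by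
    intro τ τ'
    rw [Finset.disjoint_left]
    intro w h h'
    obtain ⟨c, w', e, w'', rfl, hc, he⟩ := hmemU h
    have h'' := (mem_pureWords.mp h').2.2
    rw [isPure_cons, isPure_append, isPure_cons] at h''
    rw [← h''.2.2.1, he] at h''
    rw [h''.1] at hc
    simp at hc
  have hdW : Disjoint (pureWords σ d τ) (pureWords σ d (!τ)) := by
    rw [Finset.disjoint_left]
    intro w h h'
    rw [mem_pureWords] at h h'
    obtain ⟨c, w', rfl⟩ := List.exists_cons_of_ne_nil h.2.1
    have h₁ := (isPure_cons.mp h.2.2).1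
    rw [(isPure_cons.mp h'.2.2).1] at h₁
    simp at h₁
  have hsub : (coeff p).support ⊆
      U τ ∪ U (!τ) ∪ pureWords σ d τ ∪ pureWords σ d (!τ) ∪ {[]} := by
    intro w hw
    have hlen := hp w hw
    obtain ⟨τ', s, t, hs, ht, rfl⟩ := hpure w hw
    have key : wordStar s ++ t ∈ U τ' ∪ pureWords σ d τ' ∪ pureWords σ d (!τ') ∪ {[]} := by
      simp only [List.length_append, length_wordStar] at hlen
      simp only [Finset.mem_union, Finset.mem_singleton]
      by_cases hs0 : s = []
      · subst hs0
        by_cases ht0 : t = []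
        · subst ht0
          simp
        · exact Or.inl (Or.inl (Or.inr (mem_pureWords.mpr ⟨by simp; omega, ht0, ht⟩)))
      · by_cases ht0 : t = []
        · subst ht0
          refine Or.inl (Or.inr ?_)
          rw [List.append_nil, wordStar_mem_pureWords, Bool.not_not, mem_pureWords]
          exact ⟨by omega, hs0, hs⟩
        · refine Or.inl (Or.inl (Or.inl (Finset.mem_image.mpr ⟨(s, t), ?_, rfl⟩)))
          simp only [Finset.mem_product, mem_pureWords]
          exact ⟨⟨by omega, hs0, hs⟩, by omega, ht0, ht⟩
    simp only [Finset.mem_union] at key ⊢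
    rcases Bool.eq_or_eq_not τ' τ with rfl | rfl
    · tauto
    · rw [Bool.not_not] at key
      tauto
  have hd₁ : Disjoint (U τ ∪ U (!τ)) (pureWords σ d τ) :=
    Finset.disjoint_union_left.mpr ⟨hdUW _ _, hdUW _ _⟩
  have hd₂ : Disjoint (U τ ∪ U (!τ) ∪ pureWords σ d τ) (pureWords σ d (!τ)) :=
    Finset.disjoint_union_left.mpr
      ⟨Finset.disjoint_union_left.mpr ⟨hdUW _ _, hdUW _ _⟩, hdW⟩
  have hd₃ : Disjoint (U τ ∪ U (!τ) ∪ pureWords σ d τ ∪ pureWords σ d (!τ)) {[]} := by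
    have hWn : ∀ τ, ([] : List (σ ⊕ σ)) ∉ pureWords σ d τ := fun τ h => (mem_pureWords.mp h).2.1 rfl
    have hUn : ∀ τ, ([] : List (σ ⊕ σ)) ∉ U τ := fun τ h => by
      obtain ⟨_, _, _, _, h, -⟩ := hmemU h
      simp at h
    simp [hWn, hUn]
  rw [Finsupp.sum_of_support_subset _ hsub _ (by simp), Finset.sum_union hd₃,
    Finset.sum_union hd₂, Finset.sum_union hd₁, Finset.sum_union hdU, hU, hU,
    Finset.sum_singleton]

section Gram

variable {m : Type*} [Fintype m] [DecidableEq m] [DecidableEq σ] {X : σ → Matrix m m ℝ}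
  {p : NCPoly σ} {d : ℕ}

/-- The Gram matrix of the coefficients of the words `s^* t`, for `s`, `t` of pure type `τ`, is
positive semidefinite. -/
theorem IsSymmetric.posSemidef_gram (hsymm : IsSymmetric p)
    (hp : ∀ w ∈ (coeff p).support, w.length ≤ d)
    (hpure : ∀ w ∈ (coeff p).support, ∃ τ s t, IsPure τ s ∧ IsPure τ t ∧ w = wordStar s ++ t)
    (hQ : ∀ y : List (σ ⊕ σ) → m → ℝ,
      0 ≤ (coeff p).sum fun w r => r * splitForm X y y [] w)
    {e : m → ℝ} (he : e ≠ 0) (τ : Bool) :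
    (Matrix.of fun s t : pureWords σ d τ => coeff p (wordStar s.1 ++ t.1)).PosSemidef := by
  refine .of_dotProduct_mulVec_nonneg ?_ fun a => ?_
  · ext s t
    have h := hsymm.coeff_wordStar (wordStar s.1 ++ t.1)
    rw [wordStar_append, wordStar_wordStar] at h
    simpa using h
  -- Extension by zero; in particular `ζ` vanishes at the empty word, as the telescoping requires.
  · let ζ : List (σ ⊕ σ) → ℝ := fun w => if h : w ∈ pureWords σ d τ then a ⟨w, h⟩ else 0
    have hζ : ζ [] = 0 := dif_neg fun h => (mem_pureWords.mp h).2.1 rfl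
    have h := hQ (pureFamily X τ ζ e)
    have hdec := sum_coeff_eq_of_isPure hp hpure
      (splitForm X (pureFamily X τ ζ e) (pureFamily X τ ζ e) []) τ
    simp only [smul_eq_mul] at hdec
    rw [hdec] at h
    have h₁ : ∀ s ∈ pureWords σ d τ, ∀ t ∈ pureWords σ d τ,
        coeff p (wordStar s ++ t) *
          splitForm X (pureFamily X τ ζ e) (pureFamily X τ ζ e) [] (wordStar s ++ t) =
        (e ⬝ᵥ e) * (ζ s * (coeff p (wordStar s ++ t) * ζ t)) := by
      intro s hs t ht
      rw [splitForm_pureFamily X hζ e (mem_pureWords.mp hs).2.2 (mem_pureWords.mp ht).2.2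
        (isPure_nil τ), hζ, List.append_nil]
      ring
    have h₂ : ∀ s ∈ pureWords σ d (!τ), ∀ t ∈ pureWords σ d (!τ),
        coeff p (wordStar s ++ t) *
          splitForm X (pureFamily X τ ζ e) (pureFamily X τ ζ e) [] (wordStar s ++ t) = 0 := by
      intro s hs t ht
      rw [splitForm_pureFamily_of_ne X ζ e (mem_pureWords.mp hs).2.2 (mem_pureWords.mp ht).2.2,
        mul_zero]
    have h₃ : ∀ s ∈ pureWords σ d τ, coeff p s *
        splitForm X (pureFamily X τ ζ e) (pureFamily X τ ζ e) [] s = 0 := by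
      intro s hs
      rw [splitForm_pureFamily_of_isPure X ζ e (mem_pureWords.mp hs).2.2, mul_zero]
    have h₄ : ∀ s ∈ pureWords σ d (!τ), coeff p s *
        splitForm X (pureFamily X τ ζ e) (pureFamily X τ ζ e) [] s = 0 := by
      intro s hs
      have := splitForm_pureFamily_of_ne X ζ e (isPure_nil _) (mem_pureWords.mp hs).2.2 []
      rw [wordStar_nil, List.nil_append] at this
      rw [this, mul_zero]
    rw [Finset.sum_congr rfl fun s hs => Finset.sum_congr rfl (h₁ s hs),
      Finset.sum_eq_zero fun s hs => Finset.sum_eq_zero (h₂ s hs),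
      Finset.sum_eq_zero h₃, Finset.sum_eq_zero h₄] at h
    simp only [splitForm, mul_zero, add_zero, ← Finset.mul_sum] at h
    have hpos : 0 < e ⬝ᵥ e :=
      lt_of_le_of_ne (by simpa using dotProduct_star_self_nonneg e)
        fun h => he (dotProduct_self_eq_zero.mp h.symm)
    have h' := nonneg_of_mul_nonneg_right h hpos
    rw [← Finset.sum_coe_sort (pureWords σ d τ)] at h'
    simp only [dotProduct, Matrix.mulVec, Matrix.of_apply, star_trivial]
    convert h' using 2 with s
    rw [← Finset.sum_coe_sort (pureWords σ d τ)]
    simp [ζ]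

omit [DecidableEq σ] in
/-- A positive semidefinite Gram matrix gives a sum of squares. -/
theorem exists_sum_transpose_mul_self {τ : Bool}
    (h : (Matrix.of fun s t : pureWords σ d τ => coeff p (wordStar s.1 ++ t.1)).PosSemidef) :
    ∃ (n : ℕ) (a : Fin n → pureWords σ d τ → ℝ),
      ∑ s ∈ pureWords σ d τ, ∑ t ∈ pureWords σ d τ,
        coeff p (wordStar s ++ t) • word (wordStar s ++ t) =
      ∑ i, transpose (∑ s, a i s • word s.1) * ∑ s, a i s • word s.1 := by
  obtain ⟨n, a, ha⟩ := Matrix.posSemidef_iff_eq_sum_vecMulVec.mp h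
  refine ⟨n, a, ?_⟩
  have hentry : ∀ s t : pureWords σ d τ, coeff p (wordStar s.1 ++ t.1) = ∑ i, a i s * a i t := by
    intro s t
    have := congrFun (congrFun ha s) t
    simpa [Matrix.sum_apply, Matrix.vecMulVec_apply] using this
  rw [← Finset.sum_coe_sort (pureWords σ d τ)]
  simp_rw [← Finset.sum_coe_sort (pureWords σ d τ) (fun t => coeff p (wordStar _ ++ t) • _),
    hentry, Finset.sum_smul, transpose_sum, transpose_smul, transpose_word, Finset.sum_mul_sum,
    smul_mul_smul_comm, word_append]
  rw [Finset.sum_comm]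
  rw [Finset.sum_congr rfl fun t _ => Finset.sum_comm, Finset.sum_comm]
  exact Finset.sum_congr rfl fun i _ => Finset.sum_comm

end Gram

omit [Fintype σ] in
theorem isAnalytic_word {w : List (σ ⊕ σ)} (hw : IsPure true w) : IsAnalytic (word w) := by
  induction w with
  | nil => exact one_mem _
  | cons c w ih =>
    rw [isPure_cons] at hw
    rw [word_cons]
    refine mul_mem (Algebra.subset_adjoin ?_) (ih hw.2)
    cases c with
    | inl j => exact ⟨j, rfl⟩
    | inr j => simp at hw

omit [Fintype σ] in
theorem isAnalytic_sum_smul_word {ι : Type*} (s : Finset ι) (r : ι → ℝ)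
    (w : ι → List (σ ⊕ σ)) (hw : ∀ i ∈ s, IsPure true (w i)) :
    IsAnalytic (∑ i ∈ s, r i • word (w i)) :=
  sum_mem fun i hi => Subalgebra.smul_mem _ (isAnalytic_word (hw i hi)) _

/-- Every nonempty nc open set contains a tuple of matrices for which the words of bounded length
applied to a vector admit a dual system. -/
theorem exists_mem_dual_words [DecidableEq σ] {G : (n : ℕ) → Set (σ → Matrix (Fin n) (Fin n) ℝ)}
    (hG : IsNCOpen G) (hne : ∃ n : ℕ, 1 ≤ n ∧ (G n).Nonempty) (d : ℕ) :
    ∃ n : ℕ, 1 ≤ n ∧ ∃ X ∈ G n, ∃ (v : Fin n → ℝ) (φ : List (σ ⊕ σ) → Fin n → ℝ),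
      ∀ z w : List (σ ⊕ σ), z.length ≤ d → w.length ≤ d →
        φ z ⬝ᵥ ((w.map (letterMat X)).prod.mulVec v) = if z = w then 1 else 0 := by
  obtain ⟨hsum, n₀, -, hopen⟩ := hG
  obtain ⟨m, hm, X₀, hX₀⟩ := hne
  let W : Finset (List (σ ⊕ σ)) := (List.finite_length_le (σ ⊕ σ) d).toFinset
  have hW : ∀ w, w ∈ W ↔ w.length ≤ d := fun w => by simp [W]
  -- Enough copies to pass the threshold `n₀` for openness and to leave a separate coordinate for
  -- each word of length at most `d`.
  have hmem := hsum (n₀ + W.card + 1) (fun _ => m) (by omega) (fun _ => hm) (fun _ => X₀)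
    fun _ => hX₀
  set n := ∑ _ : Fin (n₀ + W.card + 1), m with hn
  have hle : n₀ + W.card + 1 ≤ n := by
    rw [hn]
    simp only [Finset.sum_const, Finset.card_univ, Fintype.card_fin, smul_eq_mul]
    exact Nat.le_mul_of_pos_right _ hm
  let ι : List (σ ⊕ σ) → Fin n := fun w =>
    if h : w ∈ W then Fin.castLE (by omega) (W.equivFin ⟨w, h⟩) else ⟨0, by omega⟩
  have hι : Set.InjOn ι {w | w.length ≤ d} := by
    intro w hw w' hw' h
    have h₁ : w ∈ W := (hW w).mpr hw
    have h₂ : w' ∈ W := (hW w').mpr hw'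
    simp only [ι, dif_pos h₁, dif_pos h₂] at h
    simpa using W.equivFin.injective (Fin.castLE_injective _ h)
  obtain ⟨X, hX, v, φ, hφ⟩ := exists_dual_words hι (hopen n (by omega)) ⟨_, hmem⟩
  exact ⟨n, by omega, X, hX, v, φ, hφ⟩

/-- A symmetric polynomial that is nc plurisubharmonic on a nonempty nc open set is a sum of
hereditary squares, antihereditary squares and a pluriharmonic polynomial. -/
theorem IsPlushOn.exists_sum_squares [DecidableEq σ] {p : NCPoly σ} (hp : IsSymmetric p)
    {G : (n : ℕ) → Set (σ → Matrix (Fin n) (Fin n) ℝ)} (hG : IsNCOpen G)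
    (hne : ∃ n : ℕ, 1 ≤ n ∧ (G n).Nonempty) (hplush : IsPlushOn G p) :
    ∃ (a b : ℕ) (f : Fin a → NCPoly σ) (k : Fin b → NCPoly σ) (F : NCPoly σ),
      (∀ j, IsAnalytic (f j)) ∧ (∀ j, IsAnalytic (k j)) ∧ IsAnalytic F ∧
        p = ∑ j, transpose (f j) * f j + ∑ j, k j * transpose (k j) + F + transpose F := by
  set d := (coeff p).support.sup List.length
  have hd : ∀ w ∈ (coeff p).support, w.length ≤ d := fun w hw => Finset.le_sup hw
  obtain ⟨n, hn, X, hX, v, φ, hφ⟩ := exists_mem_dual_words hG hne d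
  have hQ := sum_splitForm_nonneg hG.1 hplush hn hX hd hφ
  have hv : v ≠ 0 := by
    rintro rfl
    simpa using hφ [] [] (by simp) (by simp)
  have hpure := fun w hw => hp.exists_isPure_of_mem_support hd hφ hQ (w := w) hw
  obtain ⟨a, f, hf⟩ := exists_sum_transpose_mul_self (hp.posSemidef_gram hd hpure hQ hv true)
  obtain ⟨b, k, hk⟩ := exists_sum_transpose_mul_self (hp.posSemidef_gram hd hpure hQ hv false)
  have hdec := sum_coeff_eq_of_isPure hd hpure word true
  rw [← sum_coeff, Bool.not_true, hf, hk] at hdec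
  -- The squares of type `false` are built from words in `x^T`, so their factors are transposed to
  -- become analytic. Half of the constant term goes into `F`, since `F + F^T` counts it twice.
  refine ⟨a, b, fun i => ∑ s, f i s • word s.1, fun i => transpose (∑ s, k i s • word s.1),
    ∑ s ∈ pureWords σ d true, coeff p s • word s + (coeff p [] / 2) • 1,
    fun i => isAnalytic_sum_smul_word _ _ _ fun s _ => (mem_pureWords.mp s.2).2.2, fun i => ?_,
    add_mem (isAnalytic_sum_smul_word _ _ _ fun s hs => (mem_pureWords.mp hs).2.2)
      (Subalgebra.smul_mem _ (one_mem _) _), ?_⟩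
  · simp only [transpose_sum, transpose_smul, transpose_word]
    refine isAnalytic_sum_smul_word _ _ _ fun s _ => ?_
    rw [isPure_wordStar]
    exact (mem_pureWords.mp s.2).2.2
  · have hstar : ∑ s ∈ pureWords σ d false, coeff p s • word s =
        transpose (∑ s ∈ pureWords σ d true, coeff p s • word s) := by
      simp only [transpose_sum, transpose_smul, transpose_word]
      refine Finset.sum_nbij' wordStar wordStar ?_ ?_ ?_ ?_ ?_
      · exact fun s hs => wordStar_mem_pureWords.mpr hs
      · exact fun s hs => wordStar_mem_pureWords.mpr hs
      · exact fun s _ => wordStar_wordStar s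
      · exact fun s _ => wordStar_wordStar s
      · intro s _
        rw [hp.coeff_wordStar, wordStar_wordStar]
    have hhalf : coeff p [] • (1 : NCPoly σ) =
        (coeff p [] / 2) • 1 + (coeff p [] / 2) • 1 := by
      rw [← add_smul, add_halves]
    rw [hstar, word_nil, hhalf] at hdec
    simp only [transpose_add, transpose_smul, transpose_one, transpose_transpose]
    refine hdec.trans ?_
    abel

end NCPoly

theorem theorem1p2 (g : ℕ) (p : NCPoly (Fin g)) (hp : NCPoly.IsSymmetric p)
    (G : (n : ℕ) → Set (Fin g → Matrix (Fin n) (Fin n) ℝ)) (hG : IsNCOpen G)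
    (hne : ∃ n : ℕ, 1 ≤ n ∧ (G n).Nonempty) (hplush : NCPoly.IsPlushOn G p) :
    NCPoly.IsPlush p ∧
      ∃ (a b : ℕ) (f : Fin a → NCPoly (Fin g)) (k : Fin b → NCPoly (Fin g)) (F : NCPoly (Fin g)),
        (∀ j, NCPoly.IsAnalytic (f j)) ∧ (∀ j, NCPoly.IsAnalytic (k j)) ∧ NCPoly.IsAnalytic F ∧
        p = ∑ j, NCPoly.transpose (f j) * f j + ∑ j, k j * NCPoly.transpose (k j)
          + F + NCPoly.transpose F := by
  have h := hplush.exists_sum_squares hp hG hne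
  refine ⟨?_, h⟩
  obtain ⟨a, b, f, k, F, hf, hk, hF, rfl⟩ := h
  exact NCPoly.isPlush_sum_squares hf hk hF
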